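/- For $r>0$ let $D(r)=\{z\in\mathbb C:|z|<r\}$. A function $u\colon U\to[-\infty,+\infty)$ on an open set $U\subset\mathbb C$ is called subharmonic if it is upper semicontinuous and $u(w)\le\frac1{2\pi}\int_0^{2\pi}u(w+re^{i\theta})\,d\theta$ for every closed disc $\{|z-w|\le r\}\subset U$, $r>0$ (the function $u\equiv-\infty$ is allowed); it is called subharmonic on a set $S\subset\mathbb C$ if it is subharmonic on some open set containing $S$. A sequence $Z=\{z_k\}_{k=1,2,\dots}$ of points of $\mathbb C$ may contain repetitions, and an entire function $f$ is said to vanish on $Z$ if every point that occurs $m$ times in $Z$ is a zero of $f$ of multiplicity at least $m$ (the zero function has zeros of infinite multiplicity). Let $M\not\equiv-\infty$ be a subharmonic function on $\mathbb C$ with Riesz measure $\nu_M=\frac1{2\pi}\Delta M$ (the Laplacian being taken in the sense of distributions), and let $f$ be an entire function. Suppose that there is a number $r_0>0$ such that $\log|f|\le M$ on $\mathbb C\setminus D(r_0)$ (where $\log 0=-\infty$), and that $f$ vanishes on a sequence $Z=\{z_k\}_{k=1,2,\dots}\subset\mathbb C\setminus D(r_0)$. If $v$ is subharmonic on $\mathbb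 C\setminus D(r_0)$, $v\ge 0$ on $\mathbb C\setminus D(r_0)$, $\lim_{z\to\infty}v(z)=0$, and $$\int_{\mathbb C\setminus D(r_0)}v\,d\nu_M<+\infty,\qquad\text{but}\qquad\sum_k v(z_k)=+\infty,$$ then $f=0$. -/

import Mathlib

open MeasureTheory

noncomputable section

/-- The mean value `(1/2π) ∫₀^{2π} u(w + r e^{iθ}) dθ ∈ [-∞, +∞]` of an extended real function
over a circle: the integral of the positive part minus the integral of the negative part. The
first of the two is finite when `u` is upper semicontinuous and `< +∞` on the circle, so that no
indeterminate difference occurs there. -/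
def circleMean (u : ℂ → EReal) (w : ℂ) (r : ℝ) : EReal :=
  (((∫⁻ θ in Set.Ioc (0 : ℝ) (2 * Real.pi), (u (circleMap w r θ)).toENNReal)
      / ENNReal.ofReal (2 * Real.pi) : ENNReal) : EReal)
    - (((∫⁻ θ in Set.Ioc (0 : ℝ) (2 * Real.pi), (-u (circleMap w r θ)).toENNReal)
      / ENNReal.ofReal (2 * Real.pi) : ENNReal) : EReal)

/-- `u` is subharmonic on the open set `U`: it takes values in `[-∞, +∞)`, is upper
semicontinuous, and satisfies the sub-mean value inequality on every closed disc contained in `U`.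
The function which is identically `-∞` is allowed. -/
structure IsSubharmonicOn (u : ℂ → EReal) (U : Set ℂ) : Prop where
  isOpen : IsOpen U
  lt_top : ∀ z ∈ U, u z < ⊤
  upperSemicontinuousOn : UpperSemicontinuousOn u U
  le_circleMean : ∀ (w : ℂ) (r : ℝ), 0 < r → Metric.closedBall w r ⊆ U → u w ≤ circleMean u w r

/-- The class of functions that are subharmonic on some open set containing `S`. -/
def sbh (S : Set ℂ) : Set (ℂ → EReal) :=
  {u | ∃ U : Set ℂ, S ⊆ U ∧ IsSubharmonicOn u U}

/-- The class of functions that are subharmonic on some open set containing `S` and nonnegative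
at all points of `S`. -/
def sbhPos (S : Set ℂ) : Set (ℂ → EReal) :=
  {u | u ∈ sbh S ∧ ∀ z ∈ S, 0 ≤ u z}

/-- `ν` is the Riesz measure `(1/2π) Δ M` of a subharmonic function `M ≢ -∞` on `ℂ`: the locally
finite Borel measure which represents the distributional Laplacian of `M`, divided by `2π`. A
subharmonic function `M ≢ -∞` on `ℂ` is locally Lebesgue integrable and finite almost everywhere,
so `M` and `(M ·).toReal` define the same distribution. -/
structure IsRieszMeasure (M : ℂ → EReal) (ν : Measure ℂ) : Prop where
  isLocallyFiniteMeasure : IsLocallyFiniteMeasure ν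
  integral_eq : ∀ φ : ℂ → ℝ, ContDiff ℝ (⊤ : ℕ∞) φ → HasCompactSupport φ →
    ∫ z, φ z ∂ν = 1 / (2 * Real.pi) * ∫ z, (M z).toReal * Laplacian.laplacian φ z

/-- `f` vanishes on the sequence `Z`, counted with multiplicity: a point that occurs `m` times in
`Z` is a zero of `f` of multiplicity at least `m` (the zero function vanishes to order `∞`). -/
def VanishesOn (f : ℂ → ℂ) (Z : ℕ → ℂ) : Prop :=
  ∀ z : ℂ, {k : ℕ | Z k = z}.encard ≤ analyticOrderAt f z

end

/-!
Suppose `f ≠ 0`. The weight `v` is turned into test functions for the Riesz measure `ν` of `M`.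
With a paraboloid `q z = A ((r₀ + 3)² - ‖z‖²)` so high that `v ≤ q` for `r₀ ≤ ‖z‖ ≤ r₀ + 2`, the
function `V = max q 0 (v - ε)` (`testFunction`) equals `q` near the disc of radius `r₀`, where `v`
is not defined, and has compact support because `v → 0`. It is subharmonic for large `‖z‖`, and
everywhere it satisfies the sub-mean value inequality up to the error `A r²` of the paraboloid.
Hence a radial mollification `W` of `V` is a smooth compactly supported function with `-4A ≤ Δ W`
everywhere, `0 ≤ Δ W` for `‖z‖ > r₀ + 4`, and `Δ W ≤ 0` for `‖z‖ < r₀`. The bounds are read off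
from circle means, since `4 / r²` times the deviation of the circle mean of `W` from its center
tends to `Δ W` (`tendsto_circleAverage_laplacian`).

As `M - log ‖f‖ ≥ 0` for `‖z‖ ≥ r₀`, it follows that `∫ (M - log ‖f‖) Δ W` is bounded below by
`-4A` times the `L¹` norm of `M - log ‖f‖` on a fixed disc (`integral_log_norm_mul_laplacian_le`);
both functions are locally integrable because their circle means about one point are bounded
below. On the other side, Jensen's formula bounds `∫ log ‖f‖ Δ W` below by a positive multiple of
the sum of `W` over any finite family of zeros (`sum_le_integral_log_norm_mul_laplacian`), while
`∫ M Δ W = 2π ∫ W dν`. Since `W ≥ V ≥ v - ε` at distant zeros, and `∫ W dν` is asymptotically at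
most `∫ V dν ≤ ∫ v dν + const` as the mollification shrinks, the sums of `v` over finite families
of distant zeros are bounded independently of `ε` and of the family (`exists_sum_toReal_le`). Only
finitely many terms of the sequence are not distant, and so the series of the weights converges.
-/

/-! ### Circle means of smooth functions -/

/-- Second order Taylor estimate, with the oscillation of the second derivative as error. -/
theorem abs_taylor_two_sub_le {W : ℂ → ℝ} (hW : ContDiff ℝ 2 W) {z h : ℂ} {ε : ℝ}
    (hε : ∀ x ∈ Metric.closedBall z ‖h‖,
      ‖fderiv ℝ (fderiv ℝ W) x - fderiv ℝ (fderiv ℝ W) z‖ ≤ ε) :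
    |W (z + h) - W z - fderiv ℝ W z h - fderiv ℝ (fderiv ℝ W) z h h / 2| ≤ ε * ‖h‖ ^ 2 := by
  set B := fderiv ℝ (fderiv ℝ W) with hB
  have hε0 : 0 ≤ ε := le_trans (norm_nonneg (B z - B z)) (hε z (by simp))
  have hW1 : Differentiable ℝ W := hW.differentiable (by norm_num)
  have hW2 : Differentiable ℝ (fderiv ℝ W) :=
    (hW.fderiv_right (m := 1) (by norm_num)).differentiable (by norm_num)
  have hline : ∀ t : ℝ, HasDerivAt (fun s : ℝ => z + (s : ℂ) * h) h t := fun t => by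
    simpa using ((Complex.ofRealCLM.hasDerivAt (x := t)).mul_const h).const_add z
  have hmem : ∀ t ∈ Set.Icc (0 : ℝ) 1, z + (t : ℂ) * h ∈ Metric.closedBall z ‖h‖ := by
    intro t ht
    simp only [Metric.mem_closedBall, dist_eq_norm, add_sub_cancel_left, norm_mul,
      Complex.norm_real, Real.norm_eq_abs, abs_of_nonneg ht.1]
    exact mul_le_of_le_one_left (norm_nonneg _) ht.2
  have hd1 : ∀ t : ℝ, HasDerivAt (fun s : ℝ => W (z + (s : ℂ) * h))
      (fderiv ℝ W (z + (t : ℂ) * h) h) t := fun t =>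
    (hW1 _).hasFDerivAt.comp_hasDerivAt t (hline t)
  have hd2 : ∀ t : ℝ, HasDerivAt (fun s : ℝ => fderiv ℝ W (z + (s : ℂ) * h) h)
      (B (z + (t : ℂ) * h) h h) t := fun t => by
    have := (hW2 _).hasFDerivAt.comp_hasDerivAt t (hline t)
    exact (ContinuousLinearMap.apply ℝ ℝ h).hasFDerivAt.comp_hasDerivAt t this
  -- the derivative of the remainder
  have h1 : ∀ t ∈ Set.Icc (0 : ℝ) 1,
      ‖fderiv ℝ W (z + (t : ℂ) * h) h - fderiv ℝ W z h - t * B z h h‖ ≤ ε * ‖h‖ ^ 2 := by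
    intro t ht
    have := norm_image_sub_le_of_norm_deriv_le_segment' (a := 0) (b := 1) (C := ε * ‖h‖ ^ 2)
      (f := fun s : ℝ => fderiv ℝ W (z + (s : ℂ) * h) h - s * B z h h)
      (f' := fun s => B (z + (s : ℂ) * h) h h - 1 * B z h h)
      (fun s _ => ((hd2 s).sub ((hasDerivAt_id s).mul_const _)).hasDerivWithinAt)
      (fun s hs => by
        have e := hε _ (hmem s ⟨hs.1, hs.2.le⟩)
        rw [one_mul, ← sub_apply, ← sub_apply]
        calc _ ≤ ‖B (z + (s : ℂ) * h) - B z‖ * ‖h‖ * ‖h‖ := ContinuousLinearMap.le_opNorm₂ _ _ _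
          _ ≤ ε * ‖h‖ * ‖h‖ := by gcongr
          _ = _ := by ring) t ht
    refine le_trans (le_of_eq ?_) (this.trans ?_)
    · congr 1
      simp only [Complex.ofReal_zero, zero_mul, add_zero]
      ring
    · rw [sub_zero]
      exact mul_le_of_le_one_right (by positivity) ht.2
  have := norm_image_sub_le_of_norm_deriv_le_segment' (a := 0) (b := 1) (C := ε * ‖h‖ ^ 2)
      (f := fun s : ℝ => W (z + (s : ℂ) * h) - s * fderiv ℝ W z h - s ^ 2 / 2 * B z h h)
      (f' := fun s => fderiv ℝ W (z + (s : ℂ) * h) h - 1 * fderiv ℝ W z h - s * B z h h)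
      (fun s _ => by
        have e : HasDerivAt (fun s : ℝ => s ^ 2 / 2 * B z h h) (s * B z h h) s := by
          refine (((hasDerivAt_pow 2 s).div_const 2).mul_const (B z h h)).congr_deriv ?_
          norm_num
        exact (((hd1 s).sub ((hasDerivAt_id s).mul_const _)).sub e).hasDerivWithinAt)
      (fun s hs => by
        rw [one_mul]
        exact h1 s ⟨hs.1, hs.2.le⟩) 1 ⟨zero_le_one, le_rfl⟩
  simp only [Complex.ofReal_one, one_mul, Complex.ofReal_zero, zero_mul, add_zero, sub_zero,
    mul_one, Real.norm_eq_abs] at this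
  refine le_trans (le_of_eq ?_) this
  congr 1
  ring

theorem laplacian_eq_fderiv_fderiv (W : ℂ → ℝ) (z : ℂ) :
    Laplacian.laplacian W z = fderiv ℝ (fderiv ℝ W) z 1 1
      + fderiv ℝ (fderiv ℝ W) z Complex.I Complex.I := by
  rw [InnerProductSpace.laplacian_eq_iteratedFDeriv_complexPlane]
  simp [iteratedFDeriv_two_apply]

theorem Continuous.circleIntegrable_real {W : ℂ → ℝ} (hW : Continuous W) (z : ℂ) (r : ℝ) :
    CircleIntegrable W z r :=
  (hW.continuousOn).circleIntegrable'

/-- The circle mean of a `C²` function deviates from the value at the center by `r² / 4` times the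
Laplacian, up to the oscillation of the second derivative. -/
theorem abs_circleAverage_sub_sub_laplacian_le {W : ℂ → ℝ} (hW : ContDiff ℝ 2 W) {z : ℂ} {r ε : ℝ}
    (hr : 0 ≤ r) (hε : ∀ x ∈ Metric.closedBall z r,
      ‖fderiv ℝ (fderiv ℝ W) x - fderiv ℝ (fderiv ℝ W) z‖ ≤ ε) :
    |Real.circleAverage W z r - W z - r ^ 2 / 4 * Laplacian.laplacian W z| ≤ ε * r ^ 2 := by
  set B := fderiv ℝ (fderiv ℝ W) z with hB
  set a := fderiv ℝ W z with ha
  have hcm : ∀ θ : ℝ, circleMap 0 r θ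
      = (r * Real.cos θ) • (1 : ℂ) + (r * Real.sin θ) • Complex.I := by
    intro θ
    rw [circleMap, Complex.exp_mul_I]
    simp only [zero_add, Complex.real_smul]
    push_cast
    ring
  -- the terms of first and second order on the circle
  have hlin : ∀ θ : ℝ, a (circleMap 0 r θ)
      = r * a 1 * Real.cos θ + r * a Complex.I * Real.sin θ := by
    intro θ
    rw [hcm, map_add, map_smul, map_smul, smul_eq_mul, smul_eq_mul]
    ring
  have hquad : ∀ θ : ℝ, B (circleMap 0 r θ) (circleMap 0 r θ)
      = r ^ 2 * B 1 1 * Real.cos θ ^ 2 + r ^ 2 * B Complex.I Complex.I * Real.sin θ ^ 2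
        + r ^ 2 * (B 1 Complex.I + B Complex.I 1) * (Real.sin θ * Real.cos θ) := by
    intro θ
    rw [hcm]
    simp only [map_add, map_smul, add_apply, smul_apply,
      smul_eq_mul]
    ring
  have hi : ∀ g : ℝ → ℝ, Continuous g → IntervalIntegrable g volume 0 (2 * Real.pi) :=
    fun g hg => hg.intervalIntegrable _ _
  have hlin_int : ∫ θ in (0 : ℝ)..2 * Real.pi, a (circleMap 0 r θ) = 0 := by
    simp only [hlin]
    rw [intervalIntegral.integral_add (hi _ (by fun_prop)) (hi _ (by fun_prop)),
      intervalIntegral.integral_const_mul, intervalIntegral.integral_const_mul]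
    simp
  have hquad_int : ∫ θ in (0 : ℝ)..2 * Real.pi, B (circleMap 0 r θ) (circleMap 0 r θ)
      = Real.pi * r ^ 2 * (B 1 1 + B Complex.I Complex.I) := by
    simp only [hquad]
    rw [intervalIntegral.integral_add (hi _ (by fun_prop)) (hi _ (by fun_prop)),
      intervalIntegral.integral_add (hi _ (by fun_prop)) (hi _ (by fun_prop)),
      intervalIntegral.integral_const_mul, intervalIntegral.integral_const_mul,
      intervalIntegral.integral_const_mul, integral_cos_sq, integral_sin_sq, integral_sin_mul_cos₁]
    simp
    ring
  have hWc : Continuous W := hW.continuous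
  have hcmc : Continuous (fun θ => circleMap 0 r θ) := continuous_circleMap 0 r
  have key : ‖∫ θ in (0 : ℝ)..2 * Real.pi, (W (circleMap z r θ) - W z - a (circleMap 0 r θ)
      - B (circleMap 0 r θ) (circleMap 0 r θ) / 2)‖ ≤ ε * r ^ 2 * |2 * Real.pi - 0| := by
    refine intervalIntegral.norm_integral_le_of_norm_le_const fun θ _ => ?_
    have hn : ‖circleMap 0 r θ‖ = r := by simp [abs_of_nonneg hr]
    have := abs_taylor_two_sub_le hW (z := z) (h := circleMap 0 r θ) (ε := ε) (by rwa [hn])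
    rw [hn] at this
    rw [Real.norm_eq_abs]
    convert this using 4
    rw [circleMap, circleMap, zero_add]
  have hB2 : Continuous fun θ => B (circleMap 0 r θ) (circleMap 0 r θ) :=
    (B.continuous.comp hcmc).clm_apply hcmc
  rw [intervalIntegral.integral_sub (hi _ (by fun_prop)) (hi _ (by fun_prop)),
    intervalIntegral.integral_sub (hi _ (by fun_prop)) (hi _ (by fun_prop)),
    intervalIntegral.integral_sub (hi _ (by fun_prop)) (hi _ (by fun_prop)), hlin_int,
    intervalIntegral.integral_div, hquad_int, intervalIntegral.integral_const] at key
  rw [laplacian_eq_fderiv_fderiv, Real.circleAverage, smul_eq_mul]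
  have hpi := Real.pi_pos
  simp only [Real.norm_eq_abs, sub_zero, abs_of_pos (by positivity : 0 < 2 * Real.pi)] at key
  set I := ∫ θ in (0 : ℝ)..2 * Real.pi, W (circleMap z r θ)
  have e : (2 * Real.pi)⁻¹ * I - W z - r ^ 2 / 4 * (B 1 1 + B Complex.I Complex.I)
      = (I - (2 * Real.pi) • W z - Real.pi * r ^ 2 * (B 1 1 + B Complex.I Complex.I) / 2)
        / (2 * Real.pi) := by
    rw [smul_eq_mul]
    field_simp
    ring
  rw [e, abs_div, abs_of_pos (by positivity : 0 < 2 * Real.pi), div_le_iff₀ (by positivity)]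
  exact key

/-- The Laplacian is the limit of the normalized deviations of the circle means. -/
theorem tendsto_circleAverage_laplacian {W : ℂ → ℝ} (hW : ContDiff ℝ 2 W) (z : ℂ) :
    Filter.Tendsto (fun r : ℝ => 4 / r ^ 2 * (Real.circleAverage W z r - W z))
      (nhdsWithin 0 (Set.Ioi 0)) (nhds (Laplacian.laplacian W z)) := by
  have hB : Continuous (fderiv ℝ (fderiv ℝ W)) :=
    (hW.fderiv_right (m := 1) (by norm_num)).continuous_fderiv (by norm_num)
  rw [Metric.tendsto_nhds]
  intro ε hε
  have hosc : Continuous fun x => ‖fderiv ℝ (fderiv ℝ W) x - fderiv ℝ (fderiv ℝ W) z‖ :=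
    Continuous.norm (E := ℂ →L[ℝ] ℂ →L[ℝ] ℝ) (hB.sub continuous_const)
  obtain ⟨δ, hδ, hδB⟩ := Metric.continuousAt_iff.1 (hosc.continuousAt (x := z)) (ε / 8)
    (by positivity)
  filter_upwards [Ioo_mem_nhdsGT hδ] with r hr
  have := abs_circleAverage_sub_sub_laplacian_le hW (z := z) (ε := ε / 8) hr.1.le (fun x hx => by
    have := (hδB (lt_of_le_of_lt hx hr.2)).le
    rw [Real.dist_eq, sub_self, norm_zero (E := ℂ →L[ℝ] ℂ →L[ℝ] ℝ), sub_zero] at this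
    exact (le_abs_self _).trans this)
  have hr2 : 0 < r ^ 2 := pow_pos hr.1 2
  have hr0 : r ≠ 0 := hr.1.ne'
  rw [Real.dist_eq]
  have e : 4 / r ^ 2 * (Real.circleAverage W z r - W z) - Laplacian.laplacian W z
      = 4 / r ^ 2 * (Real.circleAverage W z r - W z - r ^ 2 / 4 * Laplacian.laplacian W z) := by
    field_simp
  rw [e, abs_mul, abs_of_pos (by positivity : 0 < 4 / r ^ 2)]
  calc _ ≤ 4 / r ^ 2 * (ε / 8 * r ^ 2) := by gcongr
    _ = ε / 2 := by field_simp; norm_num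
    _ < ε := by linarith

theorem continuous_laplacian {W : ℂ → ℝ} (hW : ContDiff ℝ 2 W) :
    Continuous (Laplacian.laplacian W) := by
  have hB : Continuous (fderiv ℝ (fderiv ℝ W)) :=
    (hW.fderiv_right (m := 1) (by norm_num)).continuous_fderiv (by norm_num)
  have : Laplacian.laplacian W = fun z => fderiv ℝ (fderiv ℝ W) z 1 1
      + fderiv ℝ (fderiv ℝ W) z Complex.I Complex.I := funext (laplacian_eq_fderiv_fderiv W)
  rw [this]
  fun_prop

theorem abs_circleAverage_sub_le_of_norm_le {W : ℂ → ℝ} (hW : ContDiff ℝ 2 W) {S : ℝ}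
    (hS : ∀ x, ‖fderiv ℝ (fderiv ℝ W) x‖ ≤ S) (z : ℂ) {r : ℝ} (hr : 0 ≤ r) :
    |Real.circleAverage W z r - W z| ≤ (2 * S + S / 2) * r ^ 2 := by
  have h1 := abs_circleAverage_sub_sub_laplacian_le hW (z := z) (ε := 2 * S) hr
    (fun x _ => (norm_sub_le (E := ℂ →L[ℝ] ℂ →L[ℝ] ℝ) _ _).trans (by linarith [hS x, hS z]))
  have e : ∀ h : ℂ, ‖h‖ = 1 → |fderiv ℝ (fderiv ℝ W) z h h| ≤ S := fun h hh => by
    have := ContinuousLinearMap.le_opNorm₂ (fderiv ℝ (fderiv ℝ W) z) h h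
    rw [hh, mul_one, mul_one] at this
    exact this.trans (hS z)
  have h2 : |Laplacian.laplacian W z| ≤ 2 * S := by
    rw [laplacian_eq_fderiv_fderiv]
    exact (abs_add_le _ _).trans (by linarith [e 1 (by simp), e Complex.I (by simp)])
  have h3 : |r ^ 2 / 4 * Laplacian.laplacian W z| ≤ r ^ 2 / 4 * (2 * S) := by
    rw [abs_mul, abs_of_nonneg (by positivity)]
    gcongr
  have := abs_add_le (Real.circleAverage W z r - W z - r ^ 2 / 4 * Laplacian.laplacian W z)
    (r ^ 2 / 4 * Laplacian.laplacian W z)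
  rw [sub_add_cancel] at this
  linarith

theorem exists_norm_fderiv_fderiv_le {W : ℂ → ℝ} (hW : ContDiff ℝ 2 W)
    (hWs : HasCompactSupport W) : ∃ S : ℝ, ∀ x, ‖fderiv ℝ (fderiv ℝ W) x‖ ≤ S :=
  HasCompactSupport.exists_bound_of_continuous (E := ℂ →L[ℝ] ℂ →L[ℝ] ℝ)
    (HasCompactSupport.fderiv (F := ℂ →L[ℝ] ℝ) ℝ (hWs.fderiv ℝ))
    ((hW.fderiv_right (m := 1) (by norm_num)).continuous_fderiv (by norm_num))

theorem exists_abs_circleAverage_sub_le {W : ℂ → ℝ} (hW : ContDiff ℝ 2 W)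
    (hWs : HasCompactSupport W) :
    ∃ K : ℝ, ∀ (z : ℂ) (r : ℝ), 0 ≤ r → |Real.circleAverage W z r - W z| ≤ K * r ^ 2 :=
  (exists_norm_fderiv_fderiv_le hW hWs).elim fun S hS =>
    ⟨2 * S + S / 2, fun z _ hr => abs_circleAverage_sub_le_of_norm_le hW hS z hr⟩

/-- A sub-mean value inequality with error `A r²` on small circles bounds the Laplacian below. -/
theorem le_laplacian_of_le_circleAverage {W : ℂ → ℝ} (hW : ContDiff ℝ 2 W) {z : ℂ} {A η : ℝ}
    (hη : 0 < η) (h : ∀ r, 0 < r → r < η → W z ≤ Real.circleAverage W z r + A * r ^ 2) :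
    -(4 * A) ≤ Laplacian.laplacian W z := by
  refine ge_of_tendsto (tendsto_circleAverage_laplacian hW z) ?_
  filter_upwards [Ioo_mem_nhdsGT hη] with r hr
  have hr2 : 0 < r ^ 2 := pow_pos hr.1 2
  have := h r hr.1 hr.2
  calc -(4 * A) = 4 / r ^ 2 * (-(A * r ^ 2)) := by
        rw [mul_neg, mul_comm A, ← mul_assoc, div_mul_cancel₀ _ hr2.ne']
    _ ≤ _ := by gcongr; linarith

theorem laplacian_nonpos_of_circleAverage_le {W : ℂ → ℝ} (hW : ContDiff ℝ 2 W) {z : ℂ} {η : ℝ}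
    (hη : 0 < η) (h : ∀ r, 0 < r → r < η → Real.circleAverage W z r ≤ W z) :
    Laplacian.laplacian W z ≤ 0 := by
  refine le_of_tendsto (tendsto_circleAverage_laplacian hW z) ?_
  filter_upwards [Ioo_mem_nhdsGT hη] with r hr
  have hr2 : 0 < r ^ 2 := pow_pos hr.1 2
  exact mul_nonpos_of_nonneg_of_nonpos (by positivity) (by linarith [h r hr.1 hr.2])

/-! ### Polar coordinates and local integrability -/

/-- The Lebesgue integral over `θ ∈ (0, 2π]` of a function along a circle; it is `2π` times the
mean over the circle. -/
noncomputable def circleLIntegral (g : ℂ → ENNReal) (z : ℂ) (r : ℝ) : ENNReal :=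
  ∫⁻ θ in Set.Ioc (0 : ℝ) (2 * Real.pi), g (circleMap z r θ)

theorem circleLIntegral_mono {g h : ℂ → ENNReal} {z : ℂ} {r : ℝ}
    (H : ∀ w ∈ Metric.sphere z |r|, g w ≤ h w) : circleLIntegral g z r ≤ circleLIntegral h z r :=
  lintegral_mono fun θ => H _ (circleMap_mem_sphere' z r θ)

theorem circleLIntegral_const (c : ENNReal) (z : ℂ) (r : ℝ) :
    circleLIntegral (fun _ => c) z r = c * ENNReal.ofReal (2 * Real.pi) := by
  simp [circleLIntegral]

/-- For a nonnegative circle integrable function the two integrals along the circle agree. -/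
theorem circleLIntegral_ofReal {u : ℂ → ℝ} {z : ℂ} {r : ℝ} (hu : CircleIntegrable u z r)
    (h0 : ∀ w ∈ Metric.sphere z |r|, 0 ≤ u w) :
    circleLIntegral (fun w => ENNReal.ofReal (u w)) z r
      = ENNReal.ofReal (2 * Real.pi * Real.circleAverage u z r) := by
  have hpi : (0 : ℝ) ≤ 2 * Real.pi := by positivity
  rw [circleLIntegral, ← ofReal_integral_eq_lintegral_ofReal
    ((intervalIntegrable_iff_integrableOn_Ioc_of_le hpi).1 hu)
    (Filter.Eventually.of_forall fun θ => h0 _ (circleMap_mem_sphere' z r θ)),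
    ← intervalIntegral.integral_of_le hpi, Real.circleAverage, smul_eq_mul, ← mul_assoc,
    mul_inv_cancel₀ (by positivity), one_mul]

/-- Integration in polar coordinates about `z`. -/
theorem lintegral_sub_eq_lintegral_circleLIntegral {g : ℂ → ENNReal} (hg : Measurable g) (z : ℂ) :
    ∫⁻ w, g (z - w) = ∫⁻ r in Set.Ioi (0 : ℝ), ENNReal.ofReal r * circleLIntegral g z r := by
  have hpt : ∀ p : ℝ × ℝ, z - Complex.polarCoord.symm p = circleMap z p.1 (p.2 + Real.pi) := by
    intro p
    rw [Complex.polarCoord_symm_apply, circleMap, Complex.exp_mul_I, Complex.ofReal_add,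
      Complex.cos_add_pi, Complex.sin_add_pi]
    push_cast
    ring
  have hm : Measurable fun p : ℝ × ℝ =>
      ENNReal.ofReal p.1 * g (circleMap z p.1 (p.2 + Real.pi)) := by
    refine (by fun_prop : Measurable fun p : ℝ × ℝ => ENNReal.ofReal p.1).mul
      (hg.comp (Continuous.measurable ?_))
    unfold circleMap
    fun_prop
  rw [← Complex.lintegral_comp_polarCoord_symm]
  simp only [hpt, smul_eq_mul, polarCoord_target, Measure.volume_eq_prod]
  rw [setLIntegral_prod _ hm.aemeasurable]
  refine lintegral_congr fun r => ?_
  have hmr : Measurable fun θ : ℝ => g (circleMap z r θ) :=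
    hg.comp (continuous_circleMap z r).measurable
  dsimp only
  rw [lintegral_const_mul (f := fun y => g (circleMap z r (y + Real.pi))) _
    (hmr.comp (measurable_add_const Real.pi)), circleLIntegral]
  congr 1
  -- a translation by `π` moves the interval `(-π, π)` to `(0, 2π)`
  have := (measurePreserving_add_right volume Real.pi).setLIntegral_comp_preimage
    (s := Set.Ioo 0 (2 * Real.pi)) measurableSet_Ioo hmr
  rw [Set.preimage_add_const_Ioo] at this
  rw [← restrict_Ioo_eq_restrict_Ioc, ← this]
  congr 3 <;> ring

/-- A function which is bounded above on a disc, and whose negative part has bounded integrals along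
the concentric circles, is integrable over the disc. -/
theorem integrableOn_ball_of_circleLIntegral_neg_le {u : ℂ → ℝ} (hu : Measurable u) {c : ℂ}
    {ρ C : ℝ} (hC : ∀ z ∈ Metric.ball c ρ, u z ≤ C) {B : ENNReal} (hB : B ≠ ⊤)
    (hneg : ∀ r, 0 < r → r < ρ → circleLIntegral (fun w => ENNReal.ofReal (-u w)) c r ≤ B) :
    IntegrableOn u (Metric.ball c ρ) := by
  refine ⟨hu.aestronglyMeasurable, ?_⟩
  have hm : Measurable fun w => ENNReal.ofReal (-u w) := hu.neg.ennreal_ofReal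
  have h1 : ∫⁻ z in Metric.ball c ρ, ENNReal.ofReal (-u z) < ⊤ := by
    rw [← lintegral_indicator Metric.isOpen_ball.measurableSet,
      ← lintegral_sub_left_eq_self _ c, lintegral_sub_eq_lintegral_circleLIntegral
        (hm.indicator Metric.isOpen_ball.measurableSet)]
    calc _ ≤ ∫⁻ r in Set.Ioi (0 : ℝ), (Set.Ioo 0 ρ).indicator
            (fun _ => ENNReal.ofReal ρ * B) r := by
          refine setLIntegral_mono (measurable_const.indicator measurableSet_Ioo) fun r hr => ?_
          by_cases hrρ : r < ρ
          · rw [Set.indicator_of_mem (Set.mem_Ioo.2 ⟨hr, hrρ⟩)]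
            gcongr
            refine le_trans (circleLIntegral_mono fun w _ => ?_) (hneg r hr hrρ)
            exact Set.indicator_le_self _ _ _
          · have : circleLIntegral ((Metric.ball c ρ).indicator
                fun w => ENNReal.ofReal (-u w)) c r ≤ circleLIntegral (fun _ => 0) c r := by
              refine circleLIntegral_mono fun w hw => ?_
              rw [Set.indicator_of_notMem]
              rw [mem_sphere_iff_norm, abs_of_pos hr] at hw
              rw [Metric.mem_ball, dist_eq_norm, hw]
              exact hrρ
            rw [circleLIntegral_const, zero_mul, nonpos_iff_eq_zero] at this
            rw [this, mul_zero]
            exact zero_le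
      _ ≤ ∫⁻ r, (Set.Ioo 0 ρ).indicator (fun _ => ENNReal.ofReal ρ * B) r :=
          setLIntegral_le_lintegral _ _
      _ < ⊤ := by
          rw [lintegral_indicator measurableSet_Ioo, setLIntegral_const, Real.volume_Ioo]
          exact ENNReal.mul_lt_top (ENNReal.mul_lt_top ENNReal.ofReal_lt_top hB.lt_top)
            ENNReal.ofReal_lt_top
  have h2 : ∫⁻ z in Metric.ball c ρ, ENNReal.ofReal (u z) < ⊤ := by
    calc _ ≤ ∫⁻ _ in Metric.ball c ρ, ENNReal.ofReal C :=
          setLIntegral_mono measurable_const fun z hz => ENNReal.ofReal_le_ofReal (hC z hz)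
      _ < ⊤ := by
          rw [setLIntegral_const]
          exact ENNReal.mul_lt_top ENNReal.ofReal_lt_top measure_ball_lt_top
  calc ∫⁻ z in Metric.ball c ρ, ‖u z‖ₑ
      ≤ ∫⁻ z in Metric.ball c ρ, (ENNReal.ofReal (u z) + ENNReal.ofReal (-u z)) := by
        refine lintegral_mono fun z => ?_
        rw [Real.enorm_eq_ofReal_abs]
        rcases abs_cases (u z) with ⟨h, _⟩ | ⟨h, _⟩ <;> rw [h]
        · exact le_self_add
        · exact le_add_self
    _ < ⊤ := by
        rw [lintegral_add_left hu.ennreal_ofReal]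
        exact ENNReal.add_lt_top.2 ⟨h2, h1⟩

theorem locallyIntegrable_of_integrableOn_ball {u : ℂ → ℝ} (c : ℂ)
    (h : ∀ ρ, IntegrableOn u (Metric.ball c ρ)) : LocallyIntegrable u := by
  intro x
  exact ⟨Metric.ball c (dist x c + 1), Metric.isOpen_ball.mem_nhds (by simp), h _⟩

theorem ereal_ofReal_neg_toReal_le (x : EReal) :
    ENNReal.ofReal (-x.toReal) ≤ (-x).toENNReal := by
  by_cases hx : x = ⊥
  · simp [hx]
  · rw [EReal.toENNReal_of_ne_top (by simpa using hx), EReal.toReal_neg_eq]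

theorem exists_toReal_le_of_upperSemicontinuousOn {u : ℂ → EReal} {K : Set ℂ} (hK : IsCompact K)
    (hu : UpperSemicontinuousOn u K) (htop : ∀ z ∈ K, u z < ⊤) :
    ∃ C : ℝ, 0 ≤ C ∧ ∀ z ∈ K, u z ≤ C := by
  rcases K.eq_empty_or_nonempty with rfl | hne
  · exact ⟨0, le_rfl, by simp⟩
  · obtain ⟨a, ha, hmax⟩ := hu.exists_isMaxOn hne hK
    refine ⟨max (u a).toReal 0, le_max_right _ _, fun z hz => (hmax hz).trans ?_⟩
    exact (EReal.le_coe_toReal (htop a ha).ne).trans (EReal.coe_le_coe_iff.2 (le_max_left _ _))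

/-- A subharmonic function `M ≢ -∞` on the plane is locally integrable: about a point `z₀` with
`M z₀ ≠ -∞` the sub-mean value inequality bounds the negative part on all circles. -/
theorem locallyIntegrable_toReal_of_mem_sbh {M : ℂ → EReal} (hM : M ∈ sbh Set.univ)
    (hM_ne : ∃ z : ℂ, M z ≠ ⊥) :
    LocallyIntegrable fun z => (M z).toReal := by
  obtain ⟨U, hU, hMU⟩ := hM
  obtain rfl : U = Set.univ := Set.univ_subset_iff.1 hU
  obtain ⟨z₀, hz₀⟩ := hM_ne
  have hmeas : Measurable M := (upperSemicontinuousOn_univ_iff.1 hMU.upperSemicontinuousOn).measurable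
  refine locallyIntegrable_of_integrableOn_ball z₀ fun ρ => ?_
  obtain ⟨C, hC0, hC⟩ := exists_toReal_le_of_upperSemicontinuousOn (isCompact_closedBall z₀ ρ)
    (hMU.upperSemicontinuousOn.mono (Set.subset_univ _)) (fun z _ => hMU.lt_top z trivial)
  obtain ⟨m, hm⟩ : ∃ m : ℝ, M z₀ = m :=
    ⟨(M z₀).toReal, (EReal.coe_toReal (hMU.lt_top z₀ trivial).ne hz₀).symm⟩
  have hpi : ENNReal.ofReal (2 * Real.pi) ≠ 0 := by simp [Real.pi_pos]
  refine integrableOn_ball_of_circleLIntegral_neg_le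
    (B := ENNReal.ofReal (C - m) * ENNReal.ofReal (2 * Real.pi)) (C := C)
    (measurable_ereal_toReal.comp hmeas) (fun z hz => ?_)
    (ENNReal.mul_ne_top ENNReal.ofReal_ne_top ENNReal.ofReal_ne_top) fun r hr hrρ => ?_
  · by_cases hb : M z = ⊥
    · simpa [hb] using hC0
    · have := hC z (Metric.ball_subset_closedBall hz)
      rw [← EReal.coe_toReal (hMU.lt_top z trivial).ne hb] at this
      exact EReal.coe_le_coe_iff.1 this
  have hmean := hMU.le_circleMean z₀ r hr (Set.subset_univ _)
  set P := (∫⁻ θ in Set.Ioc (0 : ℝ) (2 * Real.pi), (M (circleMap z₀ r θ)).toENNReal)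
      / ENNReal.ofReal (2 * Real.pi) with hP
  set N := (∫⁻ θ in Set.Ioc (0 : ℝ) (2 * Real.pi), (-M (circleMap z₀ r θ)).toENNReal)
      / ENNReal.ofReal (2 * Real.pi) with hN
  have hPC : P ≤ ENNReal.ofReal C := by
    rw [hP]
    refine ENNReal.div_le_of_le_mul ?_
    rw [← circleLIntegral_const _ z₀ r]
    refine circleLIntegral_mono (g := fun w => (M w).toENNReal) fun w hw => ?_
    rw [← EReal.real_coe_toENNReal]
    refine EReal.toENNReal_le_toENNReal (hC w ?_)
    rw [abs_of_pos hr] at hw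
    exact Metric.closedBall_subset_closedBall hrρ.le (Metric.sphere_subset_closedBall hw)
  have hNC : N ≤ ENNReal.ofReal (C - m) := by
    rw [hm, circleMean, ← hP, ← hN] at hmean
    have hP' : (P : EReal) ≤ (C : EReal) := by
      have := EReal.coe_ennreal_le_coe_ennreal_iff.2 hPC
      rwa [EReal.coe_ennreal_ofReal, max_eq_left hC0] at this
    have hNt : N ≠ ⊤ := by
      intro h
      rw [h, EReal.coe_ennreal_top, EReal.sub_top] at hmean
      simp at hmean
    obtain ⟨n, hn⟩ : ∃ n : NNReal, N = n := ⟨N.toNNReal, (ENNReal.coe_toNNReal hNt).symm⟩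
    rw [hn] at hmean ⊢
    have h3 : (m : EReal) ≤ (C : EReal) - ((n : ℝ) : EReal) :=
      hmean.trans (EReal.sub_le_sub hP' le_rfl)
    rw [← EReal.coe_sub, EReal.coe_le_coe_iff] at h3
    rw [← ENNReal.ofReal_coe_nnreal]
    exact ENNReal.ofReal_le_ofReal (by linarith)
  calc circleLIntegral (fun w => ENNReal.ofReal (-(M w).toReal)) z₀ r
      ≤ circleLIntegral (fun w => (-M w).toENNReal) z₀ r :=
        circleLIntegral_mono fun w _ => ereal_ofReal_neg_toReal_le _
    _ = N * ENNReal.ofReal (2 * Real.pi) := by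
        rw [hN, ENNReal.div_mul_cancel hpi ENNReal.ofReal_ne_top]
        rfl
    _ ≤ _ := by gcongr

/-! ### The logarithm of the modulus of an entire function -/

theorem Differentiable.analyticOrderAt_ne_top {f : ℂ → ℂ} (hf : Differentiable ℂ f) (hf0 : f ≠ 0)
    (u : ℂ) : analyticOrderAt f u ≠ ⊤ := by
  intro h
  rw [analyticOrderAt_eq_top] at h
  exact hf0 (AnalyticOnNhd.eq_of_eventuallyEq (fun z _ => hf.analyticAt z)
    (fun z _ => analyticAt_const) h)

theorem VanishesOn.card_filter_le {f : ℂ → ℂ} {Z : ℕ → ℂ} (hfZ : VanishesOn f Z) (S : Finset ℕ)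
    {u : ℂ} (hu : analyticOrderAt f u ≠ ⊤) :
    ({k ∈ S | Z k = u} : Finset ℕ).card ≤ (analyticOrderAt f u).toNat := by
  have hsub : (({k ∈ S | Z k = u} : Finset ℕ) : Set ℕ) ⊆ {k | Z k = u} := fun k hk =>
    (Finset.mem_filter.1 (Finset.mem_coe.1 hk)).2
  have h1 : (({k ∈ S | Z k = u} : Finset ℕ) : Set ℕ).encard ≤ analyticOrderAt f u :=
    (Set.encard_le_encard hsub).trans (hfZ u)
  rw [Set.encard_coe_eq_coe_finsetCard, ← ENat.natCast_toNat hu] at h1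
  exact_mod_cast h1

/-- Jensen's formula bounds the excess of the circle mean of `log ‖f‖` over its value at the center
below by the contribution `log 2` of each of the zeros in the disc of half the radius. -/
theorem le_circleAverage_log_norm {f : ℂ → ℂ} (hf : Differentiable ℂ f) (Z : ℕ → ℂ)
    (S : Finset ℕ)
    (hS : ∀ u, ({k ∈ S | Z k = u} : Finset ℕ).card ≤ (analyticOrderAt f u).toNat)
    {z : ℂ} {r : ℝ} (hr : 0 < r) (hfz : f z ≠ 0) :
    Real.log ‖f z‖ + ∑ k ∈ S, (if ‖z - Z k‖ ≤ r / 2 then Real.log 2 else 0)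
      ≤ Real.circleAverage (fun w => Real.log ‖f w‖) z r := by
  have hf0 : f ≠ 0 := fun h => hfz (by simp [h])
  have han : AnalyticOnNhd ℂ f (Metric.closedBall z |r|) := fun w _ => hf.analyticAt w
  rw [han.circleAverage_log_norm hr.ne' hfz, add_comm]
  gcongr
  set D := MeromorphicOn.divisor f (Metric.closedBall z |r|) with hD
  have hDfin := D.finiteSupport (isCompact_closedBall z |r|)
  set T : Finset ℂ := hDfin.toFinset ∪ S.image Z with hT
  rw [finsum_eq_sum_of_support_subset (s := T) _ (fun u hu => by
    simp only [hT, Finset.coe_union, Set.mem_union, Set.Finite.coe_toFinset]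
    left
    rw [Function.mem_support] at hu ⊢
    intro h0
    exact hu (by rw [h0]; simp)),
    ← Finset.sum_fiberwise_of_maps_to (s := S) (t := T) (g := Z)
      (fun k hk => Finset.mem_union_right _ (Finset.mem_image_of_mem Z hk))]
  refine Finset.sum_le_sum fun u _ => ?_
  have hlhs : ∑ k ∈ S with Z k = u, (if ‖z - Z k‖ ≤ r / 2 then Real.log 2 else 0)
      = ({k ∈ S | Z k = u} : Finset ℕ).card * (if ‖z - u‖ ≤ r / 2 then Real.log 2 else 0) := by
    rw [← nsmul_eq_mul, ← Finset.sum_const]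
    exact Finset.sum_congr rfl fun k hk => by rw [(Finset.mem_filter.1 hk).2]
  rw [hlhs]
  by_cases hu : u ∈ Metric.closedBall z |r|
  · have hord : D u = ((analyticOrderAt f u).toNat : ℤ) := by
      rw [hD, MeromorphicOn.AnalyticOnNhd.divisor_apply han hu]
      conv_lhs => rw [← ENat.natCast_toNat (hf.analyticOrderAt_ne_top hf0 u)]
      simp
    rw [hord]
    have hcard : (({k ∈ S | Z k = u} : Finset ℕ).card : ℝ) ≤ (analyticOrderAt f u).toNat := by
      exact_mod_cast hS u
    by_cases huz : u = z
    · have : analyticOrderAt f u = 0 := by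
        rw [huz]
        exact (hf.analyticAt z).analyticOrderAt_eq_zero.2 hfz
      rw [this] at hcard ⊢
      have hc0 : (({k ∈ S | Z k = u} : Finset ℕ).card : ℝ) = 0 :=
        le_antisymm (by simpa using hcard) (Nat.cast_nonneg _)
      rw [hc0]
      simp
    · have hpos : 0 < ‖z - u‖ := norm_pos_iff.2 (sub_ne_zero.2 (Ne.symm huz))
      rw [mem_closedBall_iff_norm', abs_of_pos hr] at hu
      push_cast
      have hlog : (if ‖z - u‖ ≤ r / 2 then Real.log 2 else 0) ≤ Real.log (r * ‖z - u‖⁻¹) := by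
        split_ifs with h
        · refine Real.log_le_log two_pos ?_
          rw [← div_eq_mul_inv, le_div_iff₀ hpos]
          linarith
        · refine Real.log_nonneg ?_
          rwa [← div_eq_mul_inv, le_div_iff₀ hpos, one_mul]
      refine mul_le_mul hcard hlog ?_ (Nat.cast_nonneg _)
      split_ifs
      · exact Real.log_nonneg one_le_two
      · exact le_rfl
  · have h1 : ¬ ‖z - u‖ ≤ r / 2 := by
      rw [mem_closedBall_iff_norm', abs_of_pos hr] at hu
      intro h
      exact hu (by linarith)
    rw [if_neg h1, D.apply_eq_zero_of_notMem hu]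
    simp

theorem Differentiable.circleIntegrable_log_norm {f : ℂ → ℂ} (hf : Differentiable ℂ f) (z : ℂ)
    (r : ℝ) : CircleIntegrable (fun w => Real.log ‖f w‖) z r :=
  MeromorphicOn.circleIntegrable_log_norm fun w _ => (hf.analyticAt w).meromorphicAt

theorem Differentiable.ae_ne_zero {f : ℂ → ℂ} (hf : Differentiable ℂ f) (hf0 : f ≠ 0) :
    ∀ᵐ z, f z ≠ 0 := by
  obtain ⟨x, hx⟩ := Function.ne_iff.1 hf0
  have h := AnalyticOnNhd.preimage_zero_mem_codiscrete (f := f)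
    (fun z _ => hf.analyticAt z) (x := x) hx
  have := ae_restrict_le_codiscreteWithin (μ := (volume : Measure ℂ)) MeasurableSet.univ h
  rw [Measure.restrict_univ] at this
  exact this

theorem Differentiable.measurable_log_norm {f : ℂ → ℂ} (hf : Differentiable ℂ f) :
    Measurable fun z => Real.log ‖f z‖ :=
  Real.measurable_log.comp hf.continuous.norm.measurable

theorem Differentiable.locallyIntegrable_log_norm {f : ℂ → ℂ} (hf : Differentiable ℂ f)
    (hf0 : f ≠ 0) : LocallyIntegrable fun z => Real.log ‖f z‖ := by
  obtain ⟨z₀, hz₀⟩ := Function.ne_iff.1 hf0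
  refine locallyIntegrable_of_integrableOn_ball z₀ fun ρ => ?_
  obtain ⟨K, hK⟩ := (isCompact_closedBall z₀ ρ).exists_bound_of_continuousOn
    hf.continuous.continuousOn
  have hlogK : ∀ z ∈ Metric.closedBall z₀ ρ, Real.log ‖f z‖ ≤ K := fun z hz =>
    (Real.log_le_self (norm_nonneg _)).trans (hK z hz)
  refine integrableOn_ball_of_circleLIntegral_neg_le
    (B := ENNReal.ofReal (2 * Real.pi * (K - Real.log ‖f z₀‖))) (C := K) hf.measurable_log_norm
    (fun z hz => hlogK z (Metric.ball_subset_closedBall hz)) ENNReal.ofReal_ne_top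
    fun r hr hrρ => ?_
  have hK0 : 0 ≤ K :=
    (norm_nonneg _).trans (hK z₀ (Metric.mem_closedBall_self (hr.trans hrρ).le))
  have hci := hf.circleIntegrable_log_norm z₀ r
  have hint : CircleIntegrable (fun w => K - Real.log ‖f w‖) z₀ r :=
    (circleIntegrable_const K z₀ r).sub hci
  calc circleLIntegral (fun w => ENNReal.ofReal (-Real.log ‖f w‖)) z₀ r
      ≤ circleLIntegral (fun w => ENNReal.ofReal (K - Real.log ‖f w‖)) z₀ r :=
        circleLIntegral_mono fun w _ => ENNReal.ofReal_le_ofReal (by linarith)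
    _ = ENNReal.ofReal (2 * Real.pi * Real.circleAverage (fun w => K - Real.log ‖f w‖) z₀ r) := by
        refine circleLIntegral_ofReal hint fun w hw => sub_nonneg.2 (hlogK w ?_)
        rw [abs_of_pos hr] at hw
        exact Metric.closedBall_subset_closedBall hrρ.le (Metric.sphere_subset_closedBall hw)
    _ ≤ _ := by
        have h1 := le_circleAverage_log_norm hf (fun _ => z₀) ∅ (fun u => by simp) hr hz₀
        rw [Real.circleAverage_fun_sub (circleIntegrable_const K z₀ r) hci,
          Real.circleAverage_const]
        simp only [Finset.sum_empty, add_zero] at h1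
        gcongr

/-! ### The logarithm of an entire function tested against a Laplacian -/

theorem circleMap_neg_radius_eq_sub (z : ℂ) (r θ : ℝ) :
    circleMap z (-r) θ = z - circleMap 0 r θ := by
  simp only [circleMap, Complex.ofReal_neg, zero_add]
  ring

theorem circleMap_eq_add (z : ℂ) (r θ : ℝ) : circleMap z r θ = z + circleMap 0 r θ := by
  simp only [circleMap, zero_add]

theorem HasCompactSupport.exists_eq_zero_of_lt_norm {W : ℂ → ℝ} (hW : HasCompactSupport W) :
    ∃ R : ℝ, ∀ z, R < ‖z‖ → W z = 0 := by
  obtain ⟨R, hR⟩ := hW.isCompact.isBounded.subset_closedBall 0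
  refine ⟨R, fun z hz => image_eq_zero_of_notMem_tsupport fun h => ?_⟩
  have := hR h
  rw [mem_closedBall_zero_iff] at this
  linarith

theorem circleAverage_eq_zero_of_lt_norm {W : ℂ → ℝ} {R r : ℝ} (hR : ∀ z, R < ‖z‖ → W z = 0)
    {z : ℂ} (hz : R + |r| < ‖z‖) : Real.circleAverage W z r = 0 := by
  refine Real.circleAverage_const_on_circle fun w hw => hR w ?_
  rw [mem_sphere_iff_norm, norm_sub_rev] at hw
  have := norm_sub_norm_le z w
  linarith

theorem Continuous.circleAverage_center {W : ℂ → ℝ} (hW : Continuous W) (r : ℝ) :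
    Continuous fun z => Real.circleAverage W z r := by
  simp only [Real.circleAverage, smul_eq_mul]
  refine continuous_const.mul
    (intervalIntegral.continuous_parametric_intervalIntegral_of_continuous' (μ := volume)
      (f := fun z θ => W (circleMap z r θ)) ?_ _ _)
  unfold Function.uncurry circleMap
  fun_prop

/-- Taking circle means is symmetric with respect to Lebesgue measure. -/
theorem integral_mul_circleAverage {u W : ℂ → ℝ} (hum : Measurable u) (hu : LocallyIntegrable u)
    (hW : Continuous W) (hWs : HasCompactSupport W) (r : ℝ) :
    Integrable (fun z => Real.circleAverage u z r * W z) ∧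
      ∫ z, u z * Real.circleAverage W z r = ∫ z, Real.circleAverage u z r * W z := by
  obtain ⟨R, hR⟩ := hWs.exists_eq_zero_of_lt_norm
  obtain ⟨C, hC⟩ := hWs.exists_bound_of_continuous hW
  have hpi : (0 : ℝ) ≤ 2 * Real.pi := by positivity
  set μ : Measure ℝ := volume.restrict (Set.Ioc 0 (2 * Real.pi)) with hμ
  have hcm : Continuous fun θ => circleMap 0 r θ := continuous_circleMap 0 r
  have hn : ∀ θ, ‖circleMap 0 r θ‖ = |r| := fun θ => by simp
  set K := Metric.closedBall (0 : ℂ) (R + |r|) with hK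
  have huK : Integrable (K.indicator u) :=
    (integrable_indicator_iff Metric.isClosed_closedBall.measurableSet).2
      (hu.integrableOn_isCompact (isCompact_closedBall _ _))
  have hH : Integrable (fun p : ℝ × ℂ => u p.2 * W (p.2 - circleMap 0 r p.1)) (μ.prod volume) := by
    refine Integrable.mono' (((integrable_const C).mul_prod huK.norm : Integrable
      (fun p : ℝ × ℂ => C * ‖K.indicator u p.2‖) (μ.prod volume)))
      (Measurable.aestronglyMeasurable (by fun_prop)) (Filter.Eventually.of_forall fun p => ?_)
    by_cases hp : p.2 ∈ K
    · rw [Set.indicator_of_mem hp, norm_mul, mul_comm]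
      gcongr
      exact hC _
    · rw [hR, mul_zero, norm_zero]
      · rw [Set.indicator_of_notMem hp, norm_zero, mul_zero]
      · rw [hK, mem_closedBall_zero_iff, not_le] at hp
        have := norm_sub_norm_le p.2 (circleMap 0 r p.1)
        rw [hn] at this
        linarith
  have hG : Integrable (fun p : ℝ × ℂ => u (p.2 + circleMap 0 r p.1) * W p.2)
      (μ.prod volume) := by
    have hsm : ∀ (θ : ℝ) (z : ℂ), u (z + circleMap 0 r θ) * W z
        = u (z + circleMap 0 r θ) * W (z + circleMap 0 r θ - circleMap 0 r θ) := fun θ z => by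
      rw [add_sub_cancel_right]
    obtain ⟨h1, h2⟩ := (integrable_prod_iff hH.1).1 hH
    refine (integrable_prod_iff (Measurable.aestronglyMeasurable (by fun_prop))).2 ⟨?_, ?_⟩
    · filter_upwards [h1] with θ hθ
      simp only [hsm]
      exact hθ.comp_add_right (circleMap 0 r θ)
    · refine h2.congr (Filter.Eventually.of_forall fun θ => ?_)
      simp only [hsm]
      exact (integral_add_right_eq_self
        (fun z => ‖u z * W (z - circleMap 0 r θ)‖) (circleMap 0 r θ)).symm
  have eG : ∀ z, ∫ θ, u (z + circleMap 0 r θ) * W z ∂μ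
      = 2 * Real.pi * (Real.circleAverage u z r * W z) := by
    intro z
    rw [integral_mul_const, Real.circleAverage, intervalIntegral.integral_of_le hpi, smul_eq_mul,
      ← mul_assoc, ← mul_assoc, mul_inv_cancel₀ (by positivity), one_mul]
    simp only [circleMap_eq_add z]
    rfl
  have eH : ∀ z, ∫ θ, u z * W (z - circleMap 0 r θ) ∂μ
      = 2 * Real.pi * (u z * Real.circleAverage W z r) := by
    intro z
    rw [integral_const_mul, ← Real.circleAverage_neg_radius, Real.circleAverage,
      intervalIntegral.integral_of_le hpi, smul_eq_mul]
    simp only [circleMap_neg_radius_eq_sub]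
    field_simp
    rfl
  have hpi0 : 2 * Real.pi ≠ 0 := by positivity
  constructor
  · have := hG.integral_prod_right
    simp only [eG] at this
    convert this.const_mul (2 * Real.pi)⁻¹ using 2
    field_simp
  · have hswG := integral_integral_swap (f := fun θ z => u (z + circleMap 0 r θ) * W z) hG
    have hswH := integral_integral_swap (f := fun θ z => u z * W (z - circleMap 0 r θ)) hH
    simp only [eG, integral_const_mul] at hswG
    simp only [eH, integral_const_mul] at hswH
    refine mul_left_cancel₀ hpi0 ?_
    rw [← hswG, ← hswH]
    refine integral_congr_ae (Filter.Eventually.of_forall fun θ => ?_)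
    simp only
    rw [← integral_add_right_eq_self (fun z => u z * W (z - circleMap 0 r θ)) (circleMap 0 r θ)]
    simp only [add_sub_cancel_right]

/-- Testing against the Laplacian of `W` is a limit of testing against its circle means. -/
theorem tendsto_integral_mul_circleAverage_sub {u W : ℂ → ℝ} (hu : LocallyIntegrable u)
    (hum : Measurable u) (hW : ContDiff ℝ 2 W) (hWs : HasCompactSupport W) :
    Filter.Tendsto (fun r : ℝ => ∫ z, u z * (4 / r ^ 2 * (Real.circleAverage W z r - W z)))
      (nhdsWithin 0 (Set.Ioi 0)) (nhds (∫ z, u z * Laplacian.laplacian W z)) := by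
  obtain ⟨R, hR⟩ := hWs.exists_eq_zero_of_lt_norm
  obtain ⟨K, hK⟩ := exists_abs_circleAverage_sub_le hW hWs
  set B := Metric.closedBall (0 : ℂ) (R + 1) with hB
  have huB : Integrable (B.indicator u) :=
    (integrable_indicator_iff Metric.isClosed_closedBall.measurableSet).2
      (hu.integrableOn_isCompact (isCompact_closedBall _ _))
  refine tendsto_integral_filter_of_dominated_convergence (fun z => ‖B.indicator u z‖ * (4 * K))
    (Filter.Eventually.of_forall fun r => ?_) ?_ (huB.norm.mul_const _)
    (Filter.Eventually.of_forall fun z => ?_)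
  · refine Measurable.aestronglyMeasurable (hum.mul ?_)
    exact (((hW.continuous.circleAverage_center r).sub hW.continuous).measurable).const_mul _
  · filter_upwards [Ioo_mem_nhdsGT zero_lt_one] with r hr
    refine Filter.Eventually.of_forall fun z => ?_
    have hr2 : 0 < r ^ 2 := pow_pos hr.1 2
    by_cases hz : z ∈ B
    · rw [Set.indicator_of_mem hz, norm_mul]
      gcongr
      rw [Real.norm_eq_abs, abs_mul, abs_of_pos (by positivity)]
      calc 4 / r ^ 2 * |Real.circleAverage W z r - W z| ≤ 4 / r ^ 2 * (K * r ^ 2) := by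
            gcongr
            exact hK z r hr.1.le
        _ = 4 * K := by
          rw [mul_comm K, ← mul_assoc, div_mul_cancel₀ _ hr2.ne']
    · rw [hB, mem_closedBall_zero_iff, not_le] at hz
      rw [circleAverage_eq_zero_of_lt_norm hR (by rw [abs_of_pos hr.1]; linarith [hr.2]),
        hR z (by linarith), sub_zero, mul_zero, mul_zero, norm_zero,
        Set.indicator_of_notMem (by rw [hB, mem_closedBall_zero_iff, not_le]; exact hz), norm_zero,
        zero_mul]
  · exact (tendsto_circleAverage_laplacian hW z).const_mul _

theorem le_setIntegral_closedBall {W : ℂ → ℝ} (hW : Continuous W) {a : ℂ} {s m : ℝ} (hs : 0 ≤ s)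
    (h : ∀ z ∈ Metric.closedBall a s, m ≤ W z) :
    m * (Real.pi * s ^ 2) ≤ ∫ z in Metric.closedBall a s, W z := by
  have hv : volume.real (Metric.closedBall a s) = Real.pi * s ^ 2 := by
    rw [Measure.real, Complex.volume_closedBall]
    simp [ENNReal.toReal_ofReal hs, mul_comm]
  calc m * (Real.pi * s ^ 2) = ∫ _ in Metric.closedBall a s, m := by
        rw [setIntegral_const, hv, smul_eq_mul, mul_comm]
    _ ≤ _ := setIntegral_mono_on
        (integrableOn_const (by exact measure_closedBall_lt_top.ne))
        (hW.continuousOn.integrableOn_compact (isCompact_closedBall a s))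
        Metric.isClosed_closedBall.measurableSet h

/-- The zeros of an entire function `f`, as masses of `Δ log ‖f‖`: tested against a nonnegative
function, the distributional Laplacian dominates a fixed positive multiple of the counting measure
of any finite family of zeros. The sharp constant `2π` is not needed. -/
theorem sum_le_integral_log_norm_mul_laplacian {f : ℂ → ℂ} (hf : Differentiable ℂ f) (hf0 : f ≠ 0)
    (Z : ℕ → ℂ) (S : Finset ℕ)
    (hS : ∀ u, ({k ∈ S | Z k = u} : Finset ℕ).card ≤ (analyticOrderAt f u).toNat)
    {W : ℂ → ℝ} (hW : ContDiff ℝ 2 W) (hWs : HasCompactSupport W) (hW0 : ∀ z, 0 ≤ W z) :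
    Real.pi * Real.log 2 * ∑ k ∈ S, W (Z k)
      ≤ ∫ z, Real.log ‖f z‖ * Laplacian.laplacian W z := by
  have hum := hf.measurable_log_norm
  have hu := hf.locallyIntegrable_log_norm hf0
  have hWc := hW.continuous
  have hlog2 : 0 < Real.log 2 := Real.log_pos one_lt_two
  have hpi := Real.pi_pos
  refine le_of_forall_pos_le_add fun ε hε => ?_
  rw [← sub_le_iff_le_add]
  -- the Laplacian is replaced by the circle means of radius `r`, which are moved over to `log ‖f‖`
  refine ge_of_tendsto (tendsto_integral_mul_circleAverage_sub hu hum hW hWs) ?_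
  set η := ε / (Real.pi * Real.log 2 * (S.card + 1)) with hη
  have hη0 : 0 < η := by positivity
  have hnear : ∀ᶠ r in nhdsWithin (0 : ℝ) (Set.Ioi 0),
      ∀ k ∈ S, ∀ z ∈ Metric.closedBall (Z k) (r / 2), W (Z k) - η ≤ W z := by
    rw [Filter.eventually_all_finset]
    intro k _
    obtain ⟨δ, hδ, hδW⟩ := Metric.continuousAt_iff.1 (hWc.continuousAt (x := Z k)) η hη0
    filter_upwards [Ioo_mem_nhdsGT hδ] with r hr z hz
    have := hδW (lt_of_le_of_lt hz (by linarith [hr.1, hr.2] : r / 2 < δ))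
    rw [Real.dist_eq] at this
    linarith [(abs_lt.1 this).1]
  filter_upwards [hnear, self_mem_nhdsWithin] with r hr hr0
  have hr0 : 0 < r := hr0
  have hr2 : 0 < r ^ 2 := pow_pos hr0 2
  obtain ⟨hint, hsymm⟩ := integral_mul_circleAverage hum hu hWc hWs r
  have hint1 : Integrable fun z => Real.log ‖f z‖ * W z :=
    hu.integrable_smul_right_of_hasCompactSupport hWc hWs
  have hint2 : Integrable fun z => Real.log ‖f z‖ * Real.circleAverage W z r := by
    obtain ⟨R, hR⟩ := hWs.exists_eq_zero_of_lt_norm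
    refine hu.integrable_smul_right_of_hasCompactSupport (hWc.circleAverage_center r) ?_
    refine HasCompactSupport.intro (isCompact_closedBall (0 : ℂ) (R + |r|)) fun z hz => ?_
    rw [mem_closedBall_zero_iff, not_le] at hz
    exact circleAverage_eq_zero_of_lt_norm hR hz
  have e1 : ∫ z, Real.log ‖f z‖ * (4 / r ^ 2 * (Real.circleAverage W z r - W z))
      = 4 / r ^ 2 * ∫ z, (Real.circleAverage (fun w => Real.log ‖f w‖) z r * W z
        - Real.log ‖f z‖ * W z) := by
    rw [integral_sub hint hint1, ← hsymm, ← integral_sub hint2 hint1, ← integral_const_mul]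
    congr 1
    ext z
    ring
  have hWball : ∀ k, Integrable
      ((Metric.closedBall (Z k) (r / 2)).indicator fun z => Real.log 2 * W z) := fun k =>
    (integrable_indicator_iff Metric.isClosed_closedBall.measurableSet).2
      ((hWc.const_mul _ : Continuous fun z => Real.log 2 * W z).continuousOn.integrableOn_compact
        (isCompact_closedBall _ _))
  have e2 : ∑ k ∈ S, ∫ z in Metric.closedBall (Z k) (r / 2), Real.log 2 * W z
      ≤ ∫ z, (Real.circleAverage (fun w => Real.log ‖f w‖) z r * W z
        - Real.log ‖f z‖ * W z) := by
    simp only [← integral_indicator Metric.isClosed_closedBall.measurableSet]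
    rw [← integral_finsetSum _ fun k _ => hWball k]
    refine integral_mono_ae (integrable_finsetSum _ fun k _ => hWball k) (hint.sub hint1) ?_
    filter_upwards [hf.ae_ne_zero hf0] with z hz
    have h1 := le_circleAverage_log_norm hf Z S hS hr0 hz
    have h2 : ∑ k ∈ S, (Metric.closedBall (Z k) (r / 2)).indicator (fun z => Real.log 2 * W z) z
        = (∑ k ∈ S, (if ‖z - Z k‖ ≤ r / 2 then Real.log 2 else 0)) * W z := by
      rw [Finset.sum_mul]
      refine Finset.sum_congr rfl fun k _ => ?_
      by_cases h : z ∈ Metric.closedBall (Z k) (r / 2)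
      · rw [Set.indicator_of_mem h, if_pos (mem_closedBall_iff_norm.1 h)]
      · rw [Set.indicator_of_notMem h, if_neg fun h' => h (mem_closedBall_iff_norm.2 h'), zero_mul]
    rw [h2, ← sub_mul]
    exact mul_le_mul_of_nonneg_right (by linarith) (hW0 z)
  rw [e1]
  calc Real.pi * Real.log 2 * ∑ k ∈ S, W (Z k) - ε
      ≤ Real.pi * Real.log 2 * ∑ k ∈ S, (W (Z k) - η) := by
        rw [Finset.sum_sub_distrib, mul_sub, Finset.sum_const, nsmul_eq_mul]
        gcongr
        rw [hη]
        field_simp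
        linarith
    _ = 4 / r ^ 2 * ∑ k ∈ S, Real.log 2 * ((W (Z k) - η) * (Real.pi * (r / 2) ^ 2)) := by
        rw [Finset.mul_sum, Finset.mul_sum]
        refine Finset.sum_congr rfl fun k _ => ?_
        field_simp
        ring
    _ ≤ 4 / r ^ 2 * ∑ k ∈ S, ∫ z in Metric.closedBall (Z k) (r / 2), Real.log 2 * W z := by
        gcongr with k hk
        rw [integral_const_mul]
        gcongr
        exact le_setIntegral_closedBall hWc (by positivity) (hr k hk)
    _ ≤ _ := by gcongr

/-! ### Radial mollification -/

/-- The radial function `z ↦ φ ‖z‖` on the plane is a smooth mollifier supported in the closed disc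
of radius `δ`. It is given by its profile `φ`, so that it is constant on circles by construction. -/
structure IsRadialMollifier (φ : ℝ → ℝ) (δ : ℝ) : Prop where
  contDiff : ContDiff ℝ (⊤ : ℕ∞) fun z : ℂ => φ ‖z‖
  nonneg : ∀ t, 0 ≤ φ t
  eq_zero : ∀ t, δ ≤ t → φ t = 0
  integral_eq_one : ∫ z : ℂ, φ ‖z‖ = 1

theorem exists_isRadialMollifier {δ : ℝ} (hδ : 0 < δ) : ∃ φ, IsRadialMollifier φ δ := by
  set ψ : ℝ → ℝ := fun t => Real.smoothTransition (1 - t ^ 2 / δ ^ 2) with hψ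
  have hsmooth : ContDiff ℝ (⊤ : ℕ∞) fun z : ℂ => ψ ‖z‖ :=
    Real.smoothTransition.contDiff.comp
      (contDiff_const.sub ((contDiff_norm_sq ℝ).div_const _))
  have h0 : ∀ t, 0 ≤ ψ t := fun t => Real.smoothTransition.nonneg _
  have hz : ∀ t, δ ≤ t → ψ t = 0 := fun t ht => by
    refine Real.smoothTransition.zero_of_nonpos ?_
    rw [sub_nonpos, le_div_iff₀ (by positivity), one_mul]
    gcongr
  have hcs : HasCompactSupport fun z : ℂ => ψ ‖z‖ :=
    HasCompactSupport.intro (isCompact_closedBall (0 : ℂ) δ) fun z hz' => by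
      rw [mem_closedBall_zero_iff, not_le] at hz'
      exact hz _ hz'.le
  have hpos : 0 < ∫ z : ℂ, ψ ‖z‖ :=
    hsmooth.continuous.integral_pos_of_hasCompactSupport_nonneg_nonzero hcs (fun z => h0 _)
      (x := 0) (by simp [hψ])
  refine ⟨fun t => (∫ z : ℂ, ψ ‖z‖)⁻¹ * ψ t, contDiff_const.mul hsmooth,
    fun t => mul_nonneg (inv_nonneg.2 hpos.le) (h0 t), fun t ht => ?_, ?_⟩
  · simp only [hz t ht, mul_zero]
  · rw [integral_const_mul, inv_mul_cancel₀ hpos.ne']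

/-- The convolution of `V` with the radial kernel of profile `φ`. -/
noncomputable def mollify (φ : ℝ → ℝ) (V : ℂ → ℝ) (z : ℂ) : ℝ :=
  ∫ w : ℂ, φ ‖w‖ * V (z - w)

/-- Nonnegative bounded measurable functions which vanish outside a disc. -/
structure IsBumpLike (V : ℂ → ℝ) (B R : ℝ) : Prop where
  measurable : Measurable V
  nonneg : ∀ z, 0 ≤ V z
  le : ∀ z, V z ≤ B
  eq_zero : ∀ z, R < ‖z‖ → V z = 0

section Mollify

variable {φ : ℝ → ℝ} {δ : ℝ} {V : ℂ → ℝ} {B R : ℝ}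

theorem IsRadialMollifier.eq_zero_of_notMem_ball (hφ : IsRadialMollifier φ δ) {w : ℂ}
    (hw : w ∉ Metric.ball (0 : ℂ) δ) : φ ‖w‖ = 0 := by
  rw [mem_ball_zero_iff, not_lt] at hw
  exact hφ.eq_zero _ hw

theorem IsRadialMollifier.hasCompactSupport (hφ : IsRadialMollifier φ δ) :
    HasCompactSupport fun z : ℂ => φ ‖z‖ :=
  HasCompactSupport.intro (isCompact_closedBall (0 : ℂ) δ) fun _ hz =>
    hφ.eq_zero_of_notMem_ball fun h => hz (Metric.ball_subset_closedBall h)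

theorem IsRadialMollifier.integrable (hφ : IsRadialMollifier φ δ) :
    Integrable fun z : ℂ => φ ‖z‖ :=
  hφ.contDiff.continuous.integrable_of_hasCompactSupport hφ.hasCompactSupport

theorem IsRadialMollifier.lintegral_eq_one (hφ : IsRadialMollifier φ δ) :
    ∫⁻ z : ℂ, ENNReal.ofReal (φ ‖z‖) = 1 := by
  rw [← ofReal_integral_eq_lintegral_ofReal hφ.integrable
    (Filter.Eventually.of_forall fun z => hφ.nonneg _), hφ.integral_eq_one, ENNReal.ofReal_one]

theorem IsBumpLike.integrable_mul (hV : IsBumpLike V B R) (hφ : IsRadialMollifier φ δ) (z : ℂ) :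
    Integrable fun w : ℂ => φ ‖w‖ * V (z - w) := by
  refine Integrable.mul_bdd (c := B) hφ.integrable
    (hV.measurable.comp (measurable_const.sub measurable_id)).aestronglyMeasurable
    (Filter.Eventually.of_forall fun w => ?_)
  rw [Real.norm_eq_abs, abs_of_nonneg (hV.nonneg _)]
  exact hV.le _

theorem mollify_nonneg (hV : IsBumpLike V B R) (hφ : IsRadialMollifier φ δ) (z : ℂ) :
    0 ≤ mollify φ V z :=
  integral_nonneg fun _ => mul_nonneg (hφ.nonneg _) (hV.nonneg _)

theorem mollify_le (hV : IsBumpLike V B R) (hφ : IsRadialMollifier φ δ) {z : ℂ} {b : ℝ}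
    (h : ∀ x ∈ Metric.ball z δ, V x ≤ b) : mollify φ V z ≤ b := by
  calc mollify φ V z ≤ ∫ w : ℂ, φ ‖w‖ * b := by
        refine integral_mono (hV.integrable_mul hφ z) (hφ.integrable.mul_const b) fun w => ?_
        by_cases hw : w ∈ Metric.ball (0 : ℂ) δ
        · refine mul_le_mul_of_nonneg_left (h _ ?_) (hφ.nonneg _)
          rwa [Metric.mem_ball, dist_eq_norm, sub_sub_cancel_left, norm_neg, ← mem_ball_zero_iff]
        · simp [hφ.eq_zero_of_notMem_ball hw]
    _ = b := by rw [integral_mul_const, hφ.integral_eq_one, one_mul]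

theorem mollify_eq_zero (hφ : IsRadialMollifier φ δ) (hV : IsBumpLike V B R) {z : ℂ}
    (hz : R + δ < ‖z‖) : mollify φ V z = 0 := by
  refine le_antisymm (mollify_le hV hφ fun x hx => (hV.eq_zero x ?_).le) (mollify_nonneg hV hφ z)
  rw [mem_ball_iff_norm'] at hx
  have := norm_sub_norm_le z x
  linarith

theorem hasCompactSupport_mollify (hV : IsBumpLike V B R) (hφ : IsRadialMollifier φ δ) :
    HasCompactSupport (mollify φ V) :=
  HasCompactSupport.intro (isCompact_closedBall (0 : ℂ) (R + δ)) fun z hz => by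
    rw [mem_closedBall_zero_iff, not_le] at hz
    exact mollify_eq_zero hφ hV hz

theorem contDiff_mollify (hV : IsBumpLike V B R) (hφ : IsRadialMollifier φ δ) :
    ContDiff ℝ (⊤ : ℕ∞) (mollify φ V) := by
  have hVl : LocallyIntegrable V := by
    refine (locallyIntegrable_const B).mono hV.measurable.aestronglyMeasurable
      (Filter.Eventually.of_forall fun z => ?_)
    rw [Real.norm_eq_abs, Real.norm_eq_abs, abs_of_nonneg (hV.nonneg z)]
    exact (hV.le z).trans (le_abs_self _)
  exact hφ.hasCompactSupport.contDiff_convolution_left (ContinuousLinearMap.mul ℝ ℝ)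
    hφ.contDiff hVl

theorem ofReal_mollify (hV : IsBumpLike V B R) (hφ : IsRadialMollifier φ δ) (z : ℂ) :
    ENNReal.ofReal (mollify φ V z)
      = ∫⁻ w : ℂ, ENNReal.ofReal (φ ‖w‖) * ENNReal.ofReal (V (z - w)) := by
  rw [mollify, ofReal_integral_eq_lintegral_ofReal (hV.integrable_mul hφ z)
    (Filter.Eventually.of_forall fun w => mul_nonneg (hφ.nonneg _) (hV.nonneg _))]
  exact lintegral_congr fun w => ENNReal.ofReal_mul (hφ.nonneg _)

theorem IsRadialMollifier.measurable (hφ : IsRadialMollifier φ δ) :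
    Measurable fun w : ℂ => ENNReal.ofReal (φ ‖w‖) :=
  hφ.contDiff.continuous.measurable.ennreal_ofReal

/-- Mollification commutes with the circle means. -/
theorem circleLIntegral_mollify (hV : IsBumpLike V B R) (hφ : IsRadialMollifier φ δ) (z : ℂ)
    (r : ℝ) : circleLIntegral (fun x => ENNReal.ofReal (mollify φ V x)) z r
      = ∫⁻ w : ℂ, ENNReal.ofReal (φ ‖w‖)
        * circleLIntegral (fun x => ENNReal.ofReal (V x)) (z - w) r := by
  have hVm := hV.measurable
  have hm := hφ.measurable
  have hcm : Measurable fun θ => circleMap 0 r θ := (continuous_circleMap 0 r).measurable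
  have hpt : ∀ (θ : ℝ) (w : ℂ), circleMap z r θ - w = circleMap (z - w) r θ := fun θ w => by
    simp only [circleMap]
    ring
  simp only [circleLIntegral, ofReal_mollify hV hφ, hpt]
  rw [lintegral_lintegral_swap]
  · refine lintegral_congr fun w => ?_
    rw [lintegral_const_mul]
    exact (hVm.comp (continuous_circleMap (z - w) r).measurable).ennreal_ofReal
  · refine Measurable.aemeasurable ?_
    simp only [circleMap_eq_add (z - _) r]
    unfold Function.uncurry
    refine (hm.comp measurable_snd).mul (hVm.comp ?_).ennreal_ofReal
    exact (measurable_const.sub measurable_snd).add (hcm.comp measurable_fst)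

theorem mollify_le_circleAverage_add (hV : IsBumpLike V B R) (hφ : IsRadialMollifier φ δ) {z : ℂ}
    {r c : ℝ} (hc : 0 ≤ c) (h : ∀ x ∈ Metric.ball z δ,
      ENNReal.ofReal (V x) * ENNReal.ofReal (2 * Real.pi)
        ≤ circleLIntegral (fun x => ENNReal.ofReal (V x)) x r + ENNReal.ofReal (2 * Real.pi * c)) :
    mollify φ V z ≤ Real.circleAverage (mollify φ V) z r + c := by
  have hpi := Real.pi_pos
  have hW := (contDiff_mollify hV hφ).continuous
  have hav : 0 ≤ Real.circleAverage (mollify φ V) z r :=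
    Real.circleAverage_nonneg_of_nonneg fun x _ => mollify_nonneg hV hφ x
  have hm := hφ.measurable
  have key : ENNReal.ofReal (mollify φ V z) * ENNReal.ofReal (2 * Real.pi)
      ≤ circleLIntegral (fun x => ENNReal.ofReal (mollify φ V x)) z r
        + ENNReal.ofReal (2 * Real.pi * c) := by
    rw [ofReal_mollify hV hφ, circleLIntegral_mollify hV hφ,
      ← lintegral_mul_const' _ _ ENNReal.ofReal_ne_top]
    calc _ ≤ ∫⁻ w : ℂ, (ENNReal.ofReal (φ ‖w‖)
            * circleLIntegral (fun x => ENNReal.ofReal (V x)) (z - w) r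
            + ENNReal.ofReal (φ ‖w‖) * ENNReal.ofReal (2 * Real.pi * c)) := by
          refine lintegral_mono fun w => ?_
          by_cases hw : w ∈ Metric.ball (0 : ℂ) δ
          · rw [mul_assoc, ← mul_add]
            gcongr
            refine h _ ?_
            rwa [Metric.mem_ball, dist_eq_norm, sub_sub_cancel_left, norm_neg,
              ← mem_ball_zero_iff]
          · simp [hφ.eq_zero_of_notMem_ball hw]
      _ = _ := by
          rw [lintegral_add_right _ (hm.mul_const _), lintegral_mul_const _ hm,
            hφ.lintegral_eq_one, one_mul]
  rw [circleLIntegral_ofReal (hW.circleIntegrable_real z r) (fun x _ => mollify_nonneg hV hφ x),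
    ← ENNReal.ofReal_mul (mollify_nonneg hV hφ z), ← ENNReal.ofReal_add (by positivity)
    (by positivity), ENNReal.ofReal_le_ofReal_iff (by positivity), mul_comm, ← mul_add] at key
  exact le_of_mul_le_mul_left key (by positivity)

theorem circleAverage_mollify_le (hV : IsBumpLike V B R) (hφ : IsRadialMollifier φ δ) {z : ℂ}
    {r : ℝ} (h : ∀ x ∈ Metric.ball z δ, circleLIntegral (fun x => ENNReal.ofReal (V x)) x r
      ≤ ENNReal.ofReal (V x) * ENNReal.ofReal (2 * Real.pi)) :
    Real.circleAverage (mollify φ V) z r ≤ mollify φ V z := by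
  have hpi := Real.pi_pos
  have hW := (contDiff_mollify hV hφ).continuous
  have key : circleLIntegral (fun x => ENNReal.ofReal (mollify φ V x)) z r
      ≤ ENNReal.ofReal (mollify φ V z) * ENNReal.ofReal (2 * Real.pi) := by
    rw [ofReal_mollify hV hφ, circleLIntegral_mollify hV hφ,
      ← lintegral_mul_const' _ _ ENNReal.ofReal_ne_top]
    refine lintegral_mono fun w => ?_
    by_cases hw : w ∈ Metric.ball (0 : ℂ) δ
    · rw [mul_assoc]
      gcongr
      refine h _ ?_
      rwa [Metric.mem_ball, dist_eq_norm, sub_sub_cancel_left, norm_neg, ← mem_ball_zero_iff]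
    · simp [hφ.eq_zero_of_notMem_ball hw]
  rw [circleLIntegral_ofReal (hW.circleIntegrable_real z r) (fun x _ => mollify_nonneg hV hφ x),
    ← ENNReal.ofReal_mul (mollify_nonneg hV hφ z), ENNReal.ofReal_le_ofReal_iff (by
      have := mollify_nonneg hV hφ z
      positivity), mul_comm (mollify φ V z)] at key
  exact le_of_mul_le_mul_left key (by positivity)

/-- Where `V` satisfies the sub-mean value inequality on small circles, a radial mollification does
not decrease it. -/
theorem le_mollify (hV : IsBumpLike V B R) (hφ : IsRadialMollifier φ δ) {z : ℂ}
    (h : ∀ r, 0 < r → r < δ → ENNReal.ofReal (V z) * ENNReal.ofReal (2 * Real.pi)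
      ≤ circleLIntegral (fun x => ENNReal.ofReal (V x)) z r) :
    V z ≤ mollify φ V z := by
  rw [← ENNReal.ofReal_le_ofReal_iff (mollify_nonneg hV hφ z), ofReal_mollify hV hφ]
  have hm := hφ.measurable
  have hVm := hV.measurable.ennreal_ofReal
  -- both kernels, with `V` and with the constant `V z`, in polar coordinates about `z`
  have hpolar : ∀ g : ℂ → ENNReal, Measurable g →
      ∫⁻ w : ℂ, ENNReal.ofReal (φ ‖w‖) * g (z - w) = ∫⁻ r in Set.Ioi (0 : ℝ),
        ENNReal.ofReal r * (ENNReal.ofReal (φ r) * circleLIntegral g z r) := by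
    intro g hg
    have := lintegral_sub_eq_lintegral_circleLIntegral
      (g := fun x => ENNReal.ofReal (φ ‖z - x‖) * g x)
      ((hm.comp (measurable_const.sub measurable_id)).mul hg) z
    simp only [sub_sub_cancel] at this
    rw [this]
    refine setLIntegral_congr_fun measurableSet_Ioi fun r hr => ?_
    congr 1
    rw [circleLIntegral, circleLIntegral,
      ← lintegral_const_mul (f := fun θ => g (circleMap z r θ)) _
        (hg.comp (continuous_circleMap z r).measurable)]
    refine lintegral_congr fun θ => ?_
    have : ‖z - circleMap z r θ‖ = r := by
      rw [← norm_neg, neg_sub, circleMap_sub_center, norm_circleMap_zero, abs_of_pos hr]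
    rw [this]
  calc ENNReal.ofReal (V z) = ∫⁻ w : ℂ, ENNReal.ofReal (φ ‖w‖) * ENNReal.ofReal (V z) := by
        rw [lintegral_mul_const _ hm, hφ.lintegral_eq_one, one_mul]
    _ ≤ _ := by
        rw [hpolar (fun _ => ENNReal.ofReal (V z)) measurable_const, hpolar _ hVm]
        refine lintegral_mono_ae ((ae_restrict_iff' measurableSet_Ioi).2
          (Filter.Eventually.of_forall fun r hr => ?_))
        by_cases hrδ : r < δ
        · rw [circleLIntegral_const]
          gcongr
          exact h r hr hrδ
        · simp [hφ.eq_zero r (not_lt.1 hrδ)]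

end Mollify

/-! ### The test function attached to the weight -/

theorem circleAverage_norm_sq (z : ℂ) (r : ℝ) :
    Real.circleAverage (fun w => ‖w‖ ^ 2) z r = ‖z‖ ^ 2 + r ^ 2 := by
  have h : ∀ θ, ‖circleMap z r θ‖ ^ 2
      = (‖z‖ ^ 2 + r ^ 2) + 2 * r * z.re * Real.cos θ + 2 * r * z.im * Real.sin θ := by
    intro θ
    rw [← Complex.normSq_eq_norm_sq, ← Complex.normSq_eq_norm_sq, Complex.normSq_apply,
      Complex.normSq_apply, circleMap, Complex.exp_mul_I]
    simp only [Complex.add_re, Complex.add_im, Complex.mul_re, Complex.mul_im, Complex.ofReal_re,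
      Complex.ofReal_im, Complex.I_re, Complex.I_im, Complex.cos_ofReal_re, Complex.sin_ofReal_re,
      Complex.cos_ofReal_im, Complex.sin_ofReal_im]
    linear_combination r ^ 2 * Real.sin_sq_add_cos_sq θ
  have hi : ∀ g : ℝ → ℝ, Continuous g → IntervalIntegrable g volume 0 (2 * Real.pi) :=
    fun g hg => hg.intervalIntegrable _ _
  rw [Real.circleAverage]
  simp only [h]
  rw [intervalIntegral.integral_add (hi _ (by fun_prop)) (hi _ (by fun_prop)),
    intervalIntegral.integral_add (hi _ (by fun_prop)) (hi _ (by fun_prop)),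
    intervalIntegral.integral_const_mul, intervalIntegral.integral_const_mul]
  have := Real.pi_pos
  simp only [intervalIntegral.integral_const, integral_cos, integral_sin, Real.sin_two_pi,
    Real.sin_zero, Real.cos_zero, Real.cos_two_pi, smul_eq_mul]
  field_simp
  ring

/-- A concave paraboloid, positive exactly on the disc of radius `r₀ + 3` if `0 < A`. -/
noncomputable def cap (r₀ A : ℝ) (z : ℂ) : ℝ := A * ((r₀ + 3) ^ 2 - ‖z‖ ^ 2)

theorem continuous_cap (r₀ A : ℝ) : Continuous (cap r₀ A) := by
  unfold cap
  fun_prop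

theorem circleAverage_cap (r₀ A : ℝ) (z : ℂ) (r : ℝ) :
    Real.circleAverage (cap r₀ A) z r = cap r₀ A z - A * r ^ 2 := by
  have : cap r₀ A = fun w => A • ((r₀ + 3) ^ 2 - ‖w‖ ^ 2) := rfl
  rw [this, Real.circleAverage_fun_smul, Real.circleAverage_fun_sub (circleIntegrable_const _ _ _)
    ((by fun_prop : Continuous fun w : ℂ => ‖w‖ ^ 2).circleIntegrable_real z r),
    Real.circleAverage_const, circleAverage_norm_sq]
  simp only [smul_eq_mul]
  ring

/-- The test function attached to a weight `v`: the maximum of `0`, of `v - ε`, and of a paraboloid,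
where `A` is to be so large that the paraboloid takes over for `r₀ ≤ ‖z‖ ≤ r₀ + 2`. It does not involve the values of `v`
for `‖z‖ < r₀ + 1`, where `v` need not be defined, and has compact support if `v → 0`. -/
noncomputable def testFunction (v : ℂ → EReal) (r₀ A ε : ℝ) (z : ℂ) : ℝ :=
  max (max (cap r₀ A z) 0) (if ‖z‖ < r₀ + 1 then 0 else (v z).toReal - ε)

section TestFunction

variable {v : ℂ → EReal} {r₀ A ε : ℝ}

theorem cap_nonneg (hr₀ : 0 < r₀) (hA : 0 ≤ A) {z : ℂ} (hz : ‖z‖ ≤ r₀ + 3) : 0 ≤ cap r₀ A z :=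
  mul_nonneg hA (by have := norm_nonneg z; nlinarith)

theorem cap_nonpos (hr₀ : 0 < r₀) (hA : 0 ≤ A) {z : ℂ} (hz : r₀ + 3 ≤ ‖z‖) : cap r₀ A z ≤ 0 :=
  mul_nonpos_of_nonneg_of_nonpos hA (by nlinarith)

theorem cap_le (hA : 0 ≤ A) (z : ℂ) : cap r₀ A z ≤ A * (r₀ + 3) ^ 2 :=
  mul_le_mul_of_nonneg_left (by have := sq_nonneg ‖z‖; linarith) hA

theorem testFunction_eq_cap (hr₀ : 0 < r₀) (hA : 0 ≤ A) (hε : 0 < ε)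
    (hvA : ∀ z : ℂ, r₀ ≤ ‖z‖ → ‖z‖ ≤ r₀ + 2 → (v z).toReal ≤ cap r₀ A z) {z : ℂ}
    (hz : ‖z‖ ≤ r₀ + 2) : testFunction v r₀ A ε z = cap r₀ A z := by
  have h0 := cap_nonneg hr₀ hA (z := z) (by linarith)
  rw [testFunction, max_eq_left h0, max_eq_left]
  split_ifs with h
  · exact h0
  · linarith [hvA z (by linarith) hz]

theorem testFunction_eq_of_le (v : ℂ → EReal) (A ε : ℝ) {z : ℂ} (hz : r₀ + 1 ≤ ‖z‖) :
    testFunction v r₀ A ε z = max (max (cap r₀ A z) 0) ((v z).toReal - ε) := by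
  rw [testFunction, if_neg (not_lt.2 hz)]

theorem testFunction_nonneg (z : ℂ) : 0 ≤ testFunction v r₀ A ε z :=
  (le_max_right _ _).trans (le_max_left _ _)

theorem sub_le_testFunction {z : ℂ} (hz : r₀ + 1 ≤ ‖z‖) :
    (v z).toReal - ε ≤ testFunction v r₀ A ε z := by
  rw [testFunction_eq_of_le v A ε hz]
  exact le_max_right _ _

theorem cap_le_testFunction (z : ℂ) : cap r₀ A z ≤ testFunction v r₀ A ε z :=
  (le_max_left _ _).trans (le_max_left _ _)

theorem mem_compl_ball_iff {z : ℂ} : z ∈ (Metric.ball (0 : ℂ) r₀)ᶜ ↔ r₀ ≤ ‖z‖ := by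
  rw [Set.mem_compl_iff, mem_ball_zero_iff, not_lt]

/-- The sub-mean value inequality of `v` in terms of Lebesgue integrals. -/
theorem ofReal_toReal_mul_le_circleLIntegral (hv : v ∈ sbhPos (Metric.ball (0 : ℂ) r₀)ᶜ) {x : ℂ}
    {r : ℝ} (hr : 0 < r) (hx : r₀ + r ≤ ‖x‖) :
    ENNReal.ofReal (v x).toReal * ENNReal.ofReal (2 * Real.pi)
      ≤ circleLIntegral (fun w => ENNReal.ofReal (v w).toReal) x r := by
  obtain ⟨⟨U, hU, hvU⟩, hv0⟩ := hv
  have hball : Metric.closedBall x r ⊆ (Metric.ball (0 : ℂ) r₀)ᶜ := fun w hw => by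
    rw [mem_compl_ball_iff]
    rw [mem_closedBall_iff_norm'] at hw
    have := norm_sub_norm_le x w
    linarith
  have hmean := hvU.le_circleMean x r hr (hball.trans hU)
  have hmem : ∀ θ, circleMap x r θ ∈ (Metric.ball (0 : ℂ) r₀)ᶜ := fun θ =>
    hball (circleMap_mem_closedBall x hr.le θ)
  have hneg : ∀ θ, (-v (circleMap x r θ)).toENNReal = 0 := fun θ =>
    EReal.toENNReal_of_nonpos (by simpa using hv0 _ (hmem θ))
  have hpos : ∀ w ∈ (Metric.ball (0 : ℂ) r₀)ᶜ, (v w).toENNReal = ENNReal.ofReal (v w).toReal :=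
    fun w hw => EReal.toENNReal_of_ne_top (hvU.lt_top w (hU hw)).ne
  have hxm := hball (Metric.mem_closedBall_self hr.le)
  rw [circleMean] at hmean
  simp only [hneg, lintegral_zero, ENNReal.zero_div, EReal.coe_ennreal_zero, sub_zero] at hmean
  rw [← EReal.coe_toENNReal (hv0 x hxm), EReal.coe_ennreal_le_coe_ennreal_iff, hpos x hxm,
    ENNReal.le_div_iff_mul_le (.inl (by simp [Real.pi_pos])) (.inl ENNReal.ofReal_ne_top)] at hmean
  refine hmean.trans (le_of_eq ?_)
  exact lintegral_congr fun θ => hpos _ (hmem θ)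

theorem ofReal_sub_mul_le_circleLIntegral (hv : v ∈ sbhPos (Metric.ball (0 : ℂ) r₀)ᶜ)
    (hε : 0 < ε) {V : ℂ → ℝ} {x : ℂ} {r : ℝ} (hr : 0 < r) (hx : r₀ + r ≤ ‖x‖)
    (hV : ∀ w ∈ Metric.sphere x |r|, (v w).toReal - ε ≤ V w) :
    ENNReal.ofReal ((v x).toReal - ε) * ENNReal.ofReal (2 * Real.pi)
      ≤ circleLIntegral (fun w => ENNReal.ofReal (V w)) x r := by
  rw [ENNReal.ofReal_sub _ hε.le, ENNReal.sub_mul (fun _ _ => ENNReal.ofReal_ne_top),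
    tsub_le_iff_right]
  calc _ ≤ circleLIntegral (fun w => ENNReal.ofReal (v w).toReal) x r :=
        ofReal_toReal_mul_le_circleLIntegral hv hr hx
    _ ≤ circleLIntegral (fun w => ENNReal.ofReal (V w) + ENNReal.ofReal ε) x r := by
        refine circleLIntegral_mono fun w hw => ?_
        refine le_trans (ENNReal.ofReal_le_ofReal ?_) ENNReal.ofReal_add_le
        linarith [hV w hw]
    _ = _ := by
        rw [← circleLIntegral_const _ x r]
        exact lintegral_add_right _ measurable_const

theorem ofReal_cap_mul_le_circleLIntegral {V : ℂ → ℝ} {x : ℂ} {r : ℝ}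
    (hV : ∀ w, cap r₀ A w ≤ V w) :
    ENNReal.ofReal (cap r₀ A x) * ENNReal.ofReal (2 * Real.pi)
      ≤ circleLIntegral (fun w => ENNReal.ofReal (V w)) x r
        + ENNReal.ofReal (2 * Real.pi * (A * r ^ 2)) := by
  have hpi := Real.pi_pos
  have hc := continuous_cap r₀ A
  have hc' : Continuous fun w => max (cap r₀ A w) 0 := hc.max continuous_const
  have h1 : cap r₀ A x ≤ Real.circleAverage (fun w => max (cap r₀ A w) 0) x r + A * r ^ 2 := by
    rw [← sub_le_iff_le_add, ← circleAverage_cap]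
    exact Real.circleAverage_mono (hc.circleIntegrable_real x r) (hc'.circleIntegrable_real x r)
      fun w _ => le_max_left _ _
  calc _ ≤ ENNReal.ofReal (2 * Real.pi
          * (Real.circleAverage (fun w => max (cap r₀ A w) 0) x r + A * r ^ 2)) := by
        rw [← ENNReal.ofReal_mul' (by positivity), mul_comm]
        gcongr
    _ ≤ circleLIntegral (fun w => ENNReal.ofReal (max (cap r₀ A w) 0)) x r
        + ENNReal.ofReal (2 * Real.pi * (A * r ^ 2)) := by
        rw [circleLIntegral_ofReal (hc'.circleIntegrable_real x r) fun w _ => le_max_right _ _,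
          mul_add]
        exact ENNReal.ofReal_add_le
    _ ≤ _ := by
        gcongr
        refine circleLIntegral_mono fun w _ => ?_
        rw [ENNReal.ofReal_max, ENNReal.ofReal_zero, max_eq_left zero_le]
        exact ENNReal.ofReal_le_ofReal (hV w)

/-- Outside the disc of radius `r₀ + 3` the test function is subharmonic. -/
theorem testFunction_mul_le_circleLIntegral (hv : v ∈ sbhPos (Metric.ball (0 : ℂ) r₀)ᶜ)
    (hr₀ : 0 < r₀) (hA : 0 ≤ A) (hε : 0 < ε) {x : ℂ} {r : ℝ} (hr : 0 < r) (hr1 : r < 1)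
    (hx : r₀ + 3 ≤ ‖x‖) :
    ENNReal.ofReal (testFunction v r₀ A ε x) * ENNReal.ofReal (2 * Real.pi)
      ≤ circleLIntegral (fun w => ENNReal.ofReal (testFunction v r₀ A ε w)) x r := by
  rw [testFunction_eq_of_le v A ε (by linarith), max_eq_right (cap_nonpos hr₀ hA hx),
    ENNReal.ofReal_max, ENNReal.ofReal_zero, max_eq_right zero_le]
  refine ofReal_sub_mul_le_circleLIntegral hv hε hr (by linarith) fun w hw => ?_
  refine sub_le_testFunction ?_
  rw [mem_sphere_iff_norm, norm_sub_rev, abs_of_pos hr] at hw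
  have := norm_sub_norm_le x w
  linarith

/-- On the whole plane the test function satisfies the sub-mean value inequality up to the error
`A r²` of the paraboloid. -/
theorem testFunction_mul_le_circleLIntegral_add (hv : v ∈ sbhPos (Metric.ball (0 : ℂ) r₀)ᶜ)
    (hr₀ : 0 < r₀) (hA : 0 ≤ A) (hε : 0 < ε)
    (hvA : ∀ z : ℂ, r₀ ≤ ‖z‖ → ‖z‖ ≤ r₀ + 2 → (v z).toReal ≤ cap r₀ A z)
    {x : ℂ} {r : ℝ} (hr : 0 < r) (hr1 : r < 1) :
    ENNReal.ofReal (testFunction v r₀ A ε x) * ENNReal.ofReal (2 * Real.pi)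
      ≤ circleLIntegral (fun w => ENNReal.ofReal (testFunction v r₀ A ε w)) x r
        + ENNReal.ofReal (2 * Real.pi * (A * r ^ 2)) := by
  have hcap := ofReal_cap_mul_le_circleLIntegral (r₀ := r₀) (A := A) (x := x) (r := r)
    (cap_le_testFunction (v := v) (ε := ε))
  by_cases hx : ‖x‖ ≤ r₀ + 2
  · rwa [testFunction_eq_cap hr₀ hA hε hvA hx]
  · rw [not_le] at hx
    rw [testFunction_eq_of_le v A ε (by linarith), ENNReal.ofReal_max, ENNReal.ofReal_max,
      ENNReal.ofReal_zero, max_eq_left (zero_le : 0 ≤ ENNReal.ofReal (cap r₀ A x))]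
    rcases max_choice (ENNReal.ofReal (cap r₀ A x)) (ENNReal.ofReal ((v x).toReal - ε))
      with h | h <;> rw [h]
    · exact hcap
    · refine le_add_right (ofReal_sub_mul_le_circleLIntegral hv hε hr (by linarith) fun w hw => ?_)
      refine sub_le_testFunction ?_
      rw [mem_sphere_iff_norm, norm_sub_rev, abs_of_pos hr] at hw
      have := norm_sub_norm_le x w
      linarith

/-- Near the disc of radius `r₀` the test function is superharmonic. -/
theorem circleLIntegral_le_testFunction_mul
    (hr₀ : 0 < r₀) (hA : 0 ≤ A) (hε : 0 < ε)
    (hvA : ∀ z : ℂ, r₀ ≤ ‖z‖ → ‖z‖ ≤ r₀ + 2 → (v z).toReal ≤ cap r₀ A z)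
    {x : ℂ} {r : ℝ} (hr : 0 < r) (hr1 : r < 1) (hx : ‖x‖ ≤ r₀ + 1) :
    circleLIntegral (fun w => ENNReal.ofReal (testFunction v r₀ A ε w)) x r
      ≤ ENNReal.ofReal (testFunction v r₀ A ε x) * ENNReal.ofReal (2 * Real.pi) := by
  have hpi := Real.pi_pos
  have hsph : ∀ w ∈ Metric.sphere x |r|, ‖w‖ ≤ r₀ + 2 := fun w hw => by
    rw [mem_sphere_iff_norm, abs_of_pos hr] at hw
    have := norm_sub_norm_le w x
    linarith
  calc _ ≤ circleLIntegral (fun w => ENNReal.ofReal (cap r₀ A w)) x r :=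
        circleLIntegral_mono fun w hw => by rw [testFunction_eq_cap hr₀ hA hε hvA (hsph w hw)]
    _ = ENNReal.ofReal (2 * Real.pi * (cap r₀ A x - A * r ^ 2)) := by
        rw [circleLIntegral_ofReal ((continuous_cap r₀ A).circleIntegrable_real x r)
          (fun w hw => cap_nonneg hr₀ hA (by linarith [hsph w hw])), circleAverage_cap]
    _ ≤ _ := by
        rw [testFunction_eq_cap hr₀ hA hε hvA (by linarith),
          ← ENNReal.ofReal_mul' (by positivity), mul_comm]
        gcongr
        have : 0 ≤ A * r ^ 2 := by positivity
        linarith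

theorem upperSemicontinuous_testFunction (hv : v ∈ sbhPos (Metric.ball (0 : ℂ) r₀)ᶜ)
    (hr₀ : 0 < r₀) (hA : 0 ≤ A) (hε : 0 < ε)
    (hvA : ∀ z : ℂ, r₀ ≤ ‖z‖ → ‖z‖ ≤ r₀ + 2 → (v z).toReal ≤ cap r₀ A z) :
    UpperSemicontinuous (testFunction v r₀ A ε) := by
  obtain ⟨⟨U, hU, hvU⟩, hv0⟩ := hv
  have hc := continuous_cap r₀ A
  intro z y hy
  by_cases hz : ‖z‖ < r₀ + 2
  · rw [testFunction_eq_cap hr₀ hA hε hvA hz.le] at hy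
    filter_upwards [hc.continuousAt.eventually_lt continuousAt_const hy,
      continuous_norm.continuousAt.eventually_lt continuousAt_const hz] with w hw1 hw2
    rwa [testFunction_eq_cap hr₀ hA hε hvA hw2.le]
  · rw [not_lt] at hz
    rw [testFunction_eq_of_le v A ε (by linarith), max_lt_iff, max_lt_iff] at hy
    have hzU : z ∈ U := hU (mem_compl_ball_iff.2 (by linarith))
    have hvz : v z < ((y + ε : ℝ) : EReal) := by
      refine (EReal.le_coe_toReal (hvU.lt_top z hzU).ne).trans_lt ?_
      rw [EReal.coe_lt_coe_iff]
      linarith [hy.2]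
    have husc := hvU.upperSemicontinuousOn z hzU _ hvz
    rw [hvU.isOpen.nhdsWithin_eq hzU] at husc
    filter_upwards [hc.continuousAt.eventually_lt continuousAt_const hy.1.1, husc,
      continuousAt_const.eventually_lt continuous_norm.continuousAt
        (by linarith : r₀ + 1 < ‖z‖)] with w hw1 hw2 hw3
    have hwb : w ∈ (Metric.ball (0 : ℂ) r₀)ᶜ := mem_compl_ball_iff.2 (by linarith)
    rw [testFunction_eq_of_le v A ε hw3.le, max_lt_iff, max_lt_iff]
    refine ⟨⟨hw1, hy.1.2⟩, ?_⟩
    have hne : v w ≠ ⊥ := fun h => by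
      have := hv0 w hwb
      rw [h] at this
      simp at this
    rw [← EReal.coe_toReal (hvU.lt_top w (hU hwb)).ne hne, EReal.coe_lt_coe_iff] at hw2
    linarith

theorem testFunction_eq_zero (hr₀ : 0 < r₀) (hA : 0 ≤ A) {z : ℂ} (hz : r₀ + 3 ≤ ‖z‖)
    (hvz : (v z).toReal ≤ ε) : testFunction v r₀ A ε z = 0 := by
  rw [testFunction_eq_of_le v A ε (by linarith), max_eq_right (cap_nonpos hr₀ hA hz),
    max_eq_left (by linarith)]

/-- The test function is dominated by `v`, apart from a bounded part near the disc. -/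
theorem testFunction_le (hv : v ∈ sbhPos (Metric.ball (0 : ℂ) r₀)ᶜ)
    (hr₀ : 0 < r₀) (hA : 0 ≤ A) (hε : 0 < ε)
    (hvA : ∀ z : ℂ, r₀ ≤ ‖z‖ → ‖z‖ ≤ r₀ + 2 → (v z).toReal ≤ cap r₀ A z) (z : ℂ) :
    ENNReal.ofReal (testFunction v r₀ A ε z)
      ≤ (Metric.closedBall (0 : ℂ) (r₀ + 3)).indicator
          (fun _ => ENNReal.ofReal (A * (r₀ + 3) ^ 2)) z
        + (Metric.ball (0 : ℂ) r₀)ᶜ.indicator (fun z => (v z).toENNReal) z := by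
  by_cases hz : ‖z‖ ≤ r₀ + 2
  · rw [testFunction_eq_cap hr₀ hA hε hvA hz,
      Set.indicator_of_mem (mem_closedBall_zero_iff.2 (by linarith))]
    exact le_add_right (ENNReal.ofReal_le_ofReal (cap_le hA z))
  · rw [not_le] at hz
    have hzb : z ∈ (Metric.ball (0 : ℂ) r₀)ᶜ := mem_compl_ball_iff.2 (by linarith)
    obtain ⟨⟨U, hU, hvU⟩, hv0⟩ := hv
    rw [testFunction_eq_of_le v A ε (by linarith), ENNReal.ofReal_max, ENNReal.ofReal_max,
      ENNReal.ofReal_zero, max_eq_left (zero_le : 0 ≤ ENNReal.ofReal (cap r₀ A z))]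
    refine max_le (le_add_right ?_) (le_add_left ?_)
    · by_cases hz3 : ‖z‖ ≤ r₀ + 3
      · rw [Set.indicator_of_mem (mem_closedBall_zero_iff.2 hz3)]
        exact ENNReal.ofReal_le_ofReal (cap_le hA z)
      · rw [ENNReal.ofReal_of_nonpos (cap_nonpos hr₀ hA (not_le.1 hz3).le)]
        exact zero_le
    · rw [Set.indicator_of_mem hzb, EReal.toENNReal_of_ne_top (hvU.lt_top z (hU hzb)).ne]
      exact ENNReal.ofReal_le_ofReal (by linarith)

end TestFunction

/-! ### Comparison of the zeros with the Riesz measure -/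

section Comparison

variable {v : ℂ → EReal} {r₀ A ε : ℝ}

theorem exists_toReal_le_cap (hv : v ∈ sbhPos (Metric.ball (0 : ℂ) r₀)ᶜ) (hr₀ : 0 < r₀) :
    ∃ A : ℝ, 0 ≤ A ∧ ∀ z : ℂ, r₀ ≤ ‖z‖ → ‖z‖ ≤ r₀ + 2 → (v z).toReal ≤ cap r₀ A z := by
  obtain ⟨⟨U, hU, hvU⟩, hv0⟩ := hv
  obtain ⟨C, hC0, hC⟩ := exists_toReal_le_of_upperSemicontinuousOn
    ((isCompact_closedBall (0 : ℂ) (r₀ + 2)).diff Metric.isOpen_ball)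
    (hvU.upperSemicontinuousOn.mono fun z hz => hU hz.2) (fun z hz => hvU.lt_top z (hU hz.2))
  -- on the annulus the paraboloid with `A = C` is at least `C ((r₀ + 3)² - (r₀ + 2)²) ≥ C`
  refine ⟨C, hC0, fun z h1 h2 => ?_⟩
  have hz : z ∈ (Metric.ball (0 : ℂ) r₀)ᶜ := mem_compl_ball_iff.2 h1
  have h3 : (v z).toReal ≤ C := by
    have h4 := hC z ⟨mem_closedBall_zero_iff.2 h2, hz⟩
    rw [← EReal.coe_toReal (hvU.lt_top z (hU hz)).ne
      (((EReal.bot_lt_zero).trans_le (hv0 z hz)).ne')] at h4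
    exact EReal.coe_le_coe_iff.1 h4
  have h5 : 1 ≤ (r₀ + 3) ^ 2 - ‖z‖ ^ 2 := by nlinarith
  exact h3.trans (le_mul_of_one_le_right hC0 h5)

theorem exists_toReal_le_of_lt_norm (hv_lim : Filter.Tendsto v (Filter.cocompact ℂ) (nhds 0))
    (hε : 0 < ε) (R₀ : ℝ) : ∃ R : ℝ, R₀ ≤ R ∧ ∀ z : ℂ, R < ‖z‖ → (v z).toReal ≤ ε := by
  have h : ∀ᶠ z in Filter.cocompact ℂ, v z < ε :=
    hv_lim.eventually_lt_const (EReal.coe_pos.2 hε)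
  obtain ⟨K, hK, hKε⟩ := Filter.mem_cocompact.1 h
  obtain ⟨R, hR⟩ := hK.isBounded.subset_closedBall 0
  refine ⟨max R R₀, le_max_right _ _, fun z hz => ?_⟩
  have hzK : z ∉ K := fun hz' => by
    have := mem_closedBall_zero_iff.1 (hR hz')
    linarith [le_max_left R R₀]
  have h1 : v z < ε := hKε hzK
  by_cases hb : v z = ⊥
  · rw [hb, EReal.toReal_bot]
    exact hε.le
  · rw [← EReal.coe_toReal (h1.trans (EReal.coe_lt_top ε)).ne hb, EReal.coe_lt_coe_iff] at h1
    exact h1.le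

theorem exists_isBumpLike_testFunction (hv : v ∈ sbhPos (Metric.ball (0 : ℂ) r₀)ᶜ)
    (hr₀ : 0 < r₀) (hA : 0 ≤ A) (hε : 0 < ε)
    (hvA : ∀ z : ℂ, r₀ ≤ ‖z‖ → ‖z‖ ≤ r₀ + 2 → (v z).toReal ≤ cap r₀ A z)
    (hv_lim : Filter.Tendsto v (Filter.cocompact ℂ) (nhds 0)) :
    ∃ B R : ℝ, IsBumpLike (testFunction v r₀ A ε) B R := by
  have husc := upperSemicontinuous_testFunction hv hr₀ hA hε hvA
  obtain ⟨R, hR0, hR⟩ := exists_toReal_le_of_lt_norm hv_lim hε (r₀ + 3)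
  obtain ⟨B, hB⟩ := (husc.upperSemicontinuousOn _).bddAbove_of_isCompact
    (isCompact_closedBall (0 : ℂ) R)
  have hzero : ∀ z : ℂ, R < ‖z‖ → testFunction v r₀ A ε z = 0 := fun z hz =>
    testFunction_eq_zero hr₀ hA (hR0.trans hz.le) (hR z hz)
  refine ⟨max B 0, R, husc.measurable, testFunction_nonneg, fun z => ?_, hzero⟩
  by_cases hz : ‖z‖ ≤ R
  · exact (hB ⟨z, mem_closedBall_zero_iff.2 hz, rfl⟩).trans (le_max_left _ _)
  · rw [hzero z (not_le.1 hz)]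
    exact le_max_right _ _

/-- Mollifications of an upper semicontinuous function have integrals which are asymptotically at
most the integral of the function (Fatou's lemma). -/
theorem exists_lintegral_mollify_lt {V : ℂ → ℝ} {B R : ℝ} (hV : IsBumpLike V B R)
    (husc : UpperSemicontinuous V) {ν : Measure ℂ} [IsLocallyFiniteMeasure ν] {X : ENNReal}
    (hX : ∫⁻ z, ENNReal.ofReal (V z) ∂ν < X) :
    ∃ (δ : ℝ) (φ : ℝ → ℝ), δ < 1 ∧ IsRadialMollifier φ δ ∧
      ∫⁻ z, ENNReal.ofReal (mollify φ V z) ∂ν < X := by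
  have hδ : ∀ n : ℕ, (0 : ℝ) < 1 / ((n : ℝ) + 2) := fun n => by positivity
  have hδ1 : ∀ n : ℕ, 1 / ((n : ℝ) + 2) < 1 := fun n => by
    rw [div_lt_one (by positivity)]
    linarith [n.cast_nonneg (α := ℝ)]
  choose φ hφ using fun n : ℕ => exists_isRadialMollifier (hδ n)
  have hlim : Filter.Tendsto (fun n : ℕ => 1 / ((n : ℝ) + 2)) Filter.atTop (nhds 0) :=
    tendsto_const_nhds.div_atTop
      (Filter.tendsto_atTop_add_const_right _ _ tendsto_natCast_atTop_atTop)
  have hpt : ∀ z, Filter.limsup (fun n => ENNReal.ofReal (mollify (φ n) V z)) Filter.atTop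
      ≤ ENNReal.ofReal (V z) := by
    intro z
    refine ENNReal.le_of_forall_pos_le_add fun e he _ => ?_
    have he' : (0 : ℝ) < e := he
    obtain ⟨s, hs, hsV⟩ := Metric.eventually_nhds_iff.1 (husc z (V z + e) (by linarith))
    have : ENNReal.ofReal (V z) + e = ENNReal.ofReal (V z + e) := by
      rw [ENNReal.ofReal_add (hV.nonneg z) he'.le, ENNReal.ofReal_coe_nnreal]
    rw [this]
    refine Filter.limsup_le_of_le (h := ?_)
    filter_upwards [hlim.eventually_lt_const hs] with n hn
    exact ENNReal.ofReal_le_ofReal (mollify_le hV (hφ n) fun x hx =>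
      (hsV (lt_trans hx hn)).le)
  have hfin : ∫⁻ z, (Metric.closedBall (0 : ℂ) (R + 1)).indicator
      (fun _ => ENNReal.ofReal B) z ∂ν ≠ ⊤ := by
    rw [lintegral_indicator Metric.isClosed_closedBall.measurableSet, setLIntegral_const]
    exact ENNReal.mul_ne_top ENNReal.ofReal_ne_top (isCompact_closedBall _ _).measure_lt_top.ne
  have hle := limsup_lintegral_le (μ := ν) (f := fun n z => ENNReal.ofReal (mollify (φ n) V z)) _
    (fun n => (contDiff_mollify hV (hφ n)).continuous.measurable.ennreal_ofReal)
    (fun n => Filter.Eventually.of_forall fun z => by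
      by_cases hz : z ∈ Metric.closedBall (0 : ℂ) (R + 1)
      · simp only [Set.indicator_of_mem hz]
        exact ENNReal.ofReal_le_ofReal (mollify_le hV (hφ n) fun x _ => hV.le x)
      · rw [mem_closedBall_zero_iff, not_le] at hz
        simp only [mollify_eq_zero (hφ n) hV (lt_trans (by gcongr; exact hδ1 n) hz), ENNReal.ofReal_zero]
        exact zero_le) hfin
  obtain ⟨n, hn⟩ := (Filter.eventually_lt_of_limsup_lt
    ((hle.trans (lintegral_mono hpt)).trans_lt hX)).exists
  exact ⟨_, φ n, hδ1 n, hφ n, hn⟩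

theorem le_toReal_of_log_enorm_le {m : EReal} {w : ℂ} (hw : w ≠ 0) (hm : m < ⊤)
    (h : ENNReal.log ‖w‖ₑ ≤ m) : Real.log ‖w‖ ≤ m.toReal := by
  have h1 : ENNReal.log ‖w‖ₑ = (Real.log ‖w‖ : ℝ) := by
    rw [ENNReal.log_pos_real (by simpa using hw) (by simp)]
    simp
  rw [h1] at h
  have hb : m ≠ ⊥ := fun hb => by
    rw [hb] at h
    simp at h
  rwa [← EReal.coe_toReal hm.ne hb, EReal.coe_le_coe_iff] at h

/-- The integral of `(M - log ‖f‖) Δ W` is bounded below. Where `M - log ‖f‖` may be negative, for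
`‖z‖ < r₀`, bounds on both sides of `Δ W` are available; elsewhere a lower bound suffices. -/
theorem integral_log_norm_mul_laplacian_le {M : ℂ → EReal} (hM : M ∈ sbh Set.univ)
    (hM_ne : ∃ z : ℂ, M z ≠ ⊥) {f : ℂ → ℂ} (hf : Differentiable ℂ f) (hf0 : f ≠ 0)
    (hfM : ∀ z ∈ (Metric.ball (0 : ℂ) r₀)ᶜ, ENNReal.log ‖f z‖ₑ ≤ M z)
    {W : ℂ → ℝ} (hW : ContDiff ℝ 2 W) (hWs : HasCompactSupport W) {L ρ : ℝ} (hL : 0 ≤ L)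
    (hρ : r₀ ≤ ρ) (h1 : ∀ z, -L ≤ Laplacian.laplacian W z)
    (h2 : ∀ z, ρ < ‖z‖ → 0 ≤ Laplacian.laplacian W z)
    (h3 : ∀ z, ‖z‖ < r₀ → Laplacian.laplacian W z ≤ 0) :
    ∫ z, Real.log ‖f z‖ * Laplacian.laplacian W z
      ≤ (∫ z, (M z).toReal * Laplacian.laplacian W z)
        + L * ∫ z in Metric.closedBall (0 : ℂ) ρ, |(M z).toReal - Real.log ‖f z‖| := by
  have hMi := locallyIntegrable_toReal_of_mem_sbh hM hM_ne
  have hfi := hf.locallyIntegrable_log_norm hf0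
  have hMtop : ∀ z, M z < ⊤ := by
    obtain ⟨U, hU, hMU⟩ := hM
    exact fun z => hMU.lt_top z (hU trivial)
  have hΔc := continuous_laplacian hW
  have hΔs : HasCompactSupport (Laplacian.laplacian W) := by
    obtain ⟨R, hR⟩ := hWs.exists_eq_zero_of_lt_norm
    refine HasCompactSupport.intro (isCompact_closedBall (0 : ℂ) R) fun z hz => ?_
    rw [mem_closedBall_zero_iff, not_le] at hz
    have : W =ᶠ[nhds z] fun _ => 0 := by
      filter_upwards [continuousAt_const.eventually_lt continuous_norm.continuousAt hz] with w hw
      exact hR w hw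
    rw [(InnerProductSpace.laplacian_congr_nhds this).eq_of_nhds]
    simp [laplacian_eq_fderiv_fderiv]
  have hMint : Integrable fun z => (M z).toReal * Laplacian.laplacian W z :=
    hMi.integrable_smul_right_of_hasCompactSupport hΔc hΔs
  have hfint : Integrable fun z => Real.log ‖f z‖ * Laplacian.laplacian W z :=
    hfi.integrable_smul_right_of_hasCompactSupport hΔc hΔs
  set Φ : ℂ → ℝ := fun z => (M z).toReal - Real.log ‖f z‖ with hΦ
  have hΦi : Integrable ((Metric.closedBall (0 : ℂ) ρ).indicator fun z => |Φ z|) :=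
    (integrable_indicator_iff Metric.isClosed_closedBall.measurableSet).2
      ((hMi.sub hfi).integrableOn_isCompact (isCompact_closedBall _ _)).abs
  rw [← integral_indicator Metric.isClosed_closedBall.measurableSet, ← sub_le_iff_le_add',
    ← integral_sub hfint hMint, ← integral_const_mul]
  refine integral_mono_ae (hfint.sub hMint) (hΦi.const_mul L) ?_
  filter_upwards [hf.ae_ne_zero hf0] with z hz
  have hpos : r₀ ≤ ‖z‖ → 0 ≤ Φ z := fun h => sub_nonneg.2
    (le_toReal_of_log_enorm_le hz (hMtop z) (hfM z (mem_compl_ball_iff.2 h)))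
  have e : Real.log ‖f z‖ * Laplacian.laplacian W z - (M z).toReal * Laplacian.laplacian W z
      = -(Φ z * Laplacian.laplacian W z) := by
    rw [hΦ]
    ring
  rw [e]
  by_cases hzρ : ‖z‖ ≤ ρ
  · rw [Set.indicator_of_mem (mem_closedBall_zero_iff.2 hzρ)]
    by_cases hz0 : r₀ ≤ ‖z‖
    · rw [abs_of_nonneg (hpos hz0)]
      nlinarith [mul_le_mul_of_nonneg_left (h1 z) (hpos hz0)]
    · have hΔ : |Laplacian.laplacian W z| ≤ L :=
        abs_le.2 ⟨h1 z, (h3 z (not_le.1 hz0)).trans hL⟩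
      calc -(Φ z * Laplacian.laplacian W z) ≤ |Φ z * Laplacian.laplacian W z| := neg_le_abs _
        _ = |Laplacian.laplacian W z| * |Φ z| := by rw [abs_mul, mul_comm]
        _ ≤ L * |Φ z| := by gcongr
  · rw [Set.indicator_of_notMem fun h => hzρ (mem_closedBall_zero_iff.1 h), mul_zero,
      neg_nonpos]
    rw [not_le] at hzρ
    exact mul_nonneg (hpos (hρ.trans hzρ.le)) (h2 z hzρ)

/-- The weight summed over the zeros far away from the disc is bounded uniformly over all finite
families of zeros. -/
theorem exists_sum_toReal_le {M : ℂ → EReal} (hM : M ∈ sbh Set.univ)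
    (hM_ne : ∃ z : ℂ, M z ≠ ⊥) {ν : Measure ℂ} (hν : IsRieszMeasure M ν)
    {f : ℂ → ℂ} (hf : Differentiable ℂ f) (hf0 : f ≠ 0) (hr₀ : 0 < r₀)
    (hfM : ∀ z ∈ (Metric.ball (0 : ℂ) r₀)ᶜ, ENNReal.log ‖f z‖ₑ ≤ M z)
    {Z : ℕ → ℂ} (hfZ : VanishesOn f Z)
    (hv : v ∈ sbhPos (Metric.ball (0 : ℂ) r₀)ᶜ)
    (hv_lim : Filter.Tendsto v (Filter.cocompact ℂ) (nhds 0))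
    (hv_int : ∫⁻ z in (Metric.ball (0 : ℂ) r₀)ᶜ, (v z).toENNReal ∂ν < ⊤) :
    ∃ T : ℝ, ∀ S : Finset ℕ, (∀ k ∈ S, r₀ + 4 ≤ ‖Z k‖) → ∑ k ∈ S, (v (Z k)).toReal ≤ T := by
  have := hν.isLocallyFiniteMeasure
  have hpi := Real.pi_pos
  have hκ : 0 < Real.pi * Real.log 2 := mul_pos hpi (Real.log_pos one_lt_two)
  obtain ⟨A, hA, hvA⟩ := exists_toReal_le_cap hv hr₀
  set Y := ENNReal.ofReal (A * (r₀ + 3) ^ 2) * ν (Metric.closedBall (0 : ℂ) (r₀ + 3))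
    + ∫⁻ z in (Metric.ball (0 : ℂ) r₀)ᶜ, (v z).toENNReal ∂ν with hY
  have hYtop : Y ≠ ⊤ := ENNReal.add_ne_top.2
    ⟨ENNReal.mul_ne_top ENNReal.ofReal_ne_top (isCompact_closedBall _ _).measure_lt_top.ne,
      hv_int.ne⟩
  set I := ∫ z in Metric.closedBall (0 : ℂ) (r₀ + 4), |(M z).toReal - Real.log ‖f z‖| with hI
  set T := (2 * Real.pi * (Y + 1).toReal + 4 * A * I) / (Real.pi * Real.log 2) with hT
  refine ⟨T, fun S hSZ => ?_⟩
  -- `T` does not depend on `ε`, so that `ε → 0` is possible at the end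
  have main : ∀ ε : ℝ, 0 < ε → ∑ k ∈ S, ((v (Z k)).toReal - ε) ≤ T := by
    intro ε hε
    set V := testFunction v r₀ A ε with hV
    obtain ⟨B, R, hbump⟩ := exists_isBumpLike_testFunction hv hr₀ hA hε hvA hv_lim
    have hVY : ∫⁻ z, ENNReal.ofReal (V z) ∂ν < Y + 1 := by
      refine lt_of_le_of_lt ?_ (ENNReal.lt_add_right hYtop one_ne_zero)
      refine (lintegral_mono (testFunction_le hv hr₀ hA hε hvA)).trans (le_of_eq ?_)
      rw [lintegral_add_left (measurable_const.indicator Metric.isClosed_closedBall.measurableSet),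
        lintegral_indicator Metric.isClosed_closedBall.measurableSet, setLIntegral_const,
        lintegral_indicator Metric.isOpen_ball.measurableSet.compl]
    obtain ⟨δ, φ, hδ1, hφ, hint⟩ := exists_lintegral_mollify_lt hbump
      (upperSemicontinuous_testFunction hv hr₀ hA hε hvA) hVY
    set W := mollify φ V with hWdef
    have hWsm : ContDiff ℝ (⊤ : ℕ∞) W := contDiff_mollify hbump hφ
    have hW2 : ContDiff ℝ 2 W := contDiff_infty.1 hWsm 2
    have hWs : HasCompactSupport W := hasCompactSupport_mollify hbump hφ
    have hW0 : ∀ z, 0 ≤ W z := mollify_nonneg hbump hφ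
    -- on discs of radius below `1` the mollification inherits the mean value inequalities of `V`
    have hlap1 : ∀ z, -(4 * A) ≤ Laplacian.laplacian W z := fun z =>
      le_laplacian_of_le_circleAverage hW2 one_pos fun r hr hr1 =>
        mollify_le_circleAverage_add hbump hφ (by positivity) fun x _ =>
          testFunction_mul_le_circleLIntegral_add hv hr₀ hA hε hvA hr hr1
    have hlap2 : ∀ z, r₀ + 4 < ‖z‖ → 0 ≤ Laplacian.laplacian W z := fun z hz => by
      have := le_laplacian_of_le_circleAverage hW2 (z := z) (A := 0) one_pos fun r hr hr1 => by
        rw [zero_mul]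
        refine mollify_le_circleAverage_add hbump hφ le_rfl fun x hx => le_add_right ?_
        refine testFunction_mul_le_circleLIntegral hv hr₀ hA hε hr hr1 ?_
        rw [mem_ball_iff_norm'] at hx
        have := norm_sub_norm_le z x
        linarith
      simpa using this
    have hlap3 : ∀ z, ‖z‖ < r₀ → Laplacian.laplacian W z ≤ 0 := fun z hz =>
      laplacian_nonpos_of_circleAverage_le hW2 one_pos fun r hr hr1 =>
        circleAverage_mollify_le hbump hφ fun x hx => by
          refine circleLIntegral_le_testFunction_mul hr₀ hA hε hvA hr hr1 ?_
          rw [mem_ball_iff_norm] at hx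
          have := norm_sub_norm_le x z
          linarith
    have hzeros := sum_le_integral_log_norm_mul_laplacian hf hf0 Z S
      (fun u => hfZ.card_filter_le S (hf.analyticOrderAt_ne_top hf0 u)) hW2 hWs hW0
    have hcomp := integral_log_norm_mul_laplacian_le hM hM_ne hf hf0 hfM hW2 hWs
      (by positivity : 0 ≤ 4 * A) (by linarith : r₀ ≤ r₀ + 4) hlap1 hlap2 hlap3
    have hriesz := hν.integral_eq W hWsm hWs
    have hWY : ∫ z, W z ∂ν ≤ (Y + 1).toReal := by
      rw [integral_eq_lintegral_of_nonneg_ae (Filter.Eventually.of_forall hW0)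
        hWsm.continuous.aestronglyMeasurable]
      exact ENNReal.toReal_mono (ENNReal.add_ne_top.2 ⟨hYtop, ENNReal.one_ne_top⟩) hint.le
    have hVW : ∀ k ∈ S, (v (Z k)).toReal - ε ≤ W (Z k) := fun k hk =>
      (sub_le_testFunction (by linarith [hSZ k hk])).trans (le_mollify hbump hφ fun r hr hrδ =>
        testFunction_mul_le_circleLIntegral hv hr₀ hA hε hr (hrδ.trans hδ1)
          (by linarith [hSZ k hk]))
    have hMW : ∫ z, (M z).toReal * Laplacian.laplacian W z = 2 * Real.pi * ∫ z, W z ∂ν := by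
      rw [hriesz]
      field_simp
    rw [hT, le_div_iff₀ hκ, mul_comm]
    calc Real.pi * Real.log 2 * ∑ k ∈ S, ((v (Z k)).toReal - ε)
        ≤ Real.pi * Real.log 2 * ∑ k ∈ S, W (Z k) := by
          gcongr with k hk
          exact hVW k hk
      _ ≤ 2 * Real.pi * ∫ z, W z ∂ν + 4 * A * I := by
          rw [← hMW]
          exact hzeros.trans hcomp
      _ ≤ _ := by gcongr
  refine le_of_forall_pos_le_add fun η hη => ?_
  have := main (η / (S.card + 1)) (by positivity)
  rw [Finset.sum_sub_distrib, Finset.sum_const, nsmul_eq_mul] at this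
  have h2 : (S.card : ℝ) * (η / (S.card + 1)) ≤ η := by
    rw [mul_div_assoc', div_le_iff₀ (by positivity)]
    nlinarith
  linarith

end Comparison

/-- Only finitely many terms of a sequence of zeros of `f ≠ 0` lie in a given disc. -/
theorem VanishesOn.finite_setOf_norm_le {f : ℂ → ℂ} (hf : Differentiable ℂ f) (hf0 : f ≠ 0)
    {Z : ℕ → ℂ} (hfZ : VanishesOn f Z) (R : ℝ) : {k | ‖Z k‖ ≤ R}.Finite := by
  have han : AnalyticOnNhd ℂ f (Metric.closedBall 0 R) := fun w _ => hf.analyticAt w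
  have hfin := (MeromorphicOn.divisor f (Metric.closedBall 0 R)).finiteSupport
    (isCompact_closedBall _ _)
  have hfib : ∀ u, {k | Z k = u}.Finite := fun u => by
    rw [← Set.encard_lt_top_iff]
    exact (hfZ u).trans_lt (hf.analyticOrderAt_ne_top hf0 u).lt_top
  refine (hfin.biUnion fun u _ => hfib u).subset fun k hk => ?_
  refine Set.mem_biUnion (x := Z k) ?_ rfl
  have hkR : Z k ∈ Metric.closedBall (0 : ℂ) R := mem_closedBall_zero_iff.2 hk
  rw [Function.mem_support, MeromorphicOn.AnalyticOnNhd.divisor_apply han hkR]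
  have hord : analyticOrderAt f (Z k) ≠ 0 := by
    intro h
    have h1 := hfZ (Z k)
    rw [h, nonpos_iff_eq_zero, Set.encard_eq_zero] at h1
    have h2 : k ∈ {j | Z j = Z k} := rfl
    rw [h1] at h2
    exact h2
  rw [← ENat.natCast_toNat (hf.analyticOrderAt_ne_top hf0 (Z k))] at hord ⊢
  simpa using hord

theorem corollary1 (M : ℂ → EReal) (hM : M ∈ sbh Set.univ) (hM_ne : ∃ z : ℂ, M z ≠ ⊥)
    (ν : Measure ℂ) (hν : IsRieszMeasure M ν)
    (f : ℂ → ℂ) (hf : Differentiable ℂ f)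
    (r₀ : ℝ) (hr₀ : 0 < r₀)
    (hfM : ∀ z ∈ (Metric.ball (0 : ℂ) r₀)ᶜ, ENNReal.log ‖f z‖ₑ ≤ M z)
    (Z : ℕ → ℂ) (hZ : ∀ k : ℕ, Z k ∈ (Metric.ball (0 : ℂ) r₀)ᶜ) (hfZ : VanishesOn f Z)
    (v : ℂ → EReal) (hv : v ∈ sbhPos (Metric.ball (0 : ℂ) r₀)ᶜ)
    (hv_lim : Filter.Tendsto v (Filter.cocompact ℂ) (nhds 0))
    (hv_int : ∫⁻ z in (Metric.ball (0 : ℂ) r₀)ᶜ, (v z).toENNReal ∂ν < ⊤)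
    (hv_sum : ∑' k : ℕ, (v (Z k)).toENNReal = ⊤) :
    f = 0 := by
  by_contra hf0
  -- the finitely many zeros with `‖z‖ ≤ r₀ + 4` have finite weight, the others at most `T`
  obtain ⟨T, hT⟩ := exists_sum_toReal_le hM hM_ne hν hf hf0 hr₀ hfM hfZ hv hv_lim hv_int
  have hval : ∀ k, (v (Z k)).toENNReal = ENNReal.ofReal (v (Z k)).toReal := fun k => by
    obtain ⟨⟨U, hU, hvU⟩, -⟩ := hv
    exact EReal.toENNReal_of_ne_top (hvU.lt_top _ (hU (hZ k))).ne
  have hnear := hfZ.finite_setOf_norm_le hf hf0 (r₀ + 4)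
  have hbound : ∑' k : ℕ, (v (Z k)).toENNReal
      ≤ ∑ k ∈ hnear.toFinset, (v (Z k)).toENNReal + ENNReal.ofReal T := by
    rw [ENNReal.tsum_eq_iSup_sum]
    refine iSup_le fun S => ?_
    rw [← Finset.sum_filter_add_sum_filter_not S fun k => ‖Z k‖ ≤ r₀ + 4]
    refine add_le_add (Finset.sum_le_sum_of_subset fun k hk => ?_) ?_
    · exact hnear.mem_toFinset.2 (Finset.mem_filter.1 hk).2
    · simp only [hval]
      rw [← ENNReal.ofReal_sum_of_nonneg fun k _ => EReal.toReal_nonneg (hv.2 _ (hZ k))]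
      exact ENNReal.ofReal_le_ofReal
        (hT _ fun k hk => (not_le.1 (Finset.mem_filter.1 hk).2).le)
  rw [hv_sum, top_le_iff] at hbound
  refine ENNReal.add_ne_top.2 ⟨ENNReal.sum_ne_top.2 fun k _ => ?_, ENNReal.ofReal_ne_top⟩ hbound
  rw [hval]
  exact ENNReal.ofReal_ne_top
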